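/- Let $\Sigma_3=\{0,1,2\}$, and let $f,g,t_1,t_2\colon\Sigma_3^*\to\Sigma_3^*$ be the morphisms given by \begin{align*} f(0)&=01, & f(1)&=022, & f(2)&=02,\\ g(0)&=20, & g(1)&=21, & g(2)&=2,\\ t_1(0)&=001, & t_1(1)&=00101101, & t_1(2)&=0010110100101101,\\ t_2(0)&=002, & t_2(1)&=00202202, & t_2(2)&=0020220200202202. \end{align*} Extend morphisms to infinite words letter by letter; let $f^\omega(0)=0\cdot 1\cdot f(1)\cdot f^2(1)\cdot f^3(1)\cdots$ be the infinite word that has every $f^n(0)$ as a prefix; and for an infinite word $w=w_0w_1w_2\cdots$ over $\Sigma_3$ let $\tau(w)=t_1(w_0)\,t_2(w_1)\,t_1(w_2)\,t_2(w_3)\cdots$. A finite word of length $n$ is called rich if it has exactly $n+1$ distinct palindromic factors (counting the empty word), and an infinite word is called rich if all of its finite factors are rich. **Proposition.** The infinite word $\mathbf{z}=\tau(g(f^\omega(0)))$ is rich. -/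

import Mathlib

/-! Words: a finite word over `α` is a `List α`, an infinite word over `α` is a map `ℕ → α`. -/

namespace RichWords

variable {α β : Type*}

/-- The morphism of free monoids `α* → β*` determined by its values `h` on letters. -/
def morph (h : α → List β) (w : List α) : List β := w.flatMap h

theorem le_length_flatMap_range (b : ℕ → List α) (hb : ∀ n, b n ≠ []) (n : ℕ) :
    n ≤ ((List.range n).flatMap b).length := by
  induction n with
  | zero => simp
  | succ n ih =>
    have h1 : 0 < (b n).length := List.length_pos_iff.mpr (hb n)
    rw [List.range_succ, List.flatMap_append, List.length_append]
    simp only [List.flatMap_cons, List.flatMap_nil, List.append_nil]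
    omega

/-- The infinite word `b 0 · b 1 · b 2 ⋯` obtained by concatenating nonempty finite words: its
letter of index `n` is the letter of index `n` of the finite word `b 0 · b 1 ⋯ b n`. -/
def infConcat (b : ℕ → List α) (hb : ∀ n, b n ≠ []) : ℕ → α := fun n =>
  ((List.range (n + 1)).flatMap b)[n]'(le_length_flatMap_range b hb (n + 1))

/-- The image `h(u) = h(u 0) h(u 1) h(u 2) ⋯` of an infinite word under a nonerasing morphism. -/
def morphInf (h : α → List β) (hh : ∀ a, h a ≠ []) (u : ℕ → α) : ℕ → β :=
  infConcat (fun n => h (u n)) (fun n => hh (u n))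

/-- The morphism `h` is prolongable on the letter `a`, with `h(a) = a x`. -/
def Prolongable (h : α → List α) (a : α) (x : List α) : Prop :=
  h a = a :: x ∧ ∀ n : ℕ, (morph h)^[n] x ≠ []

/-- The infinite word `h^ω(a) = a x h(x) h²(x) h³(x) ⋯`, where `h(a) = a x`. -/
def omegaWord (h : α → List α) (a : α) (x : List α) (hp : Prolongable h a x) : ℕ → α :=
  infConcat (fun n => match n with
    | 0 => [a]
    | k + 1 => (morph h)^[k] x)
    (fun n => match n with
    | 0 => List.cons_ne_nil a []
    | k + 1 => hp.2 k)

/-- The infinite word `h₁(u 0) h₂(u 1) h₁(u 2) h₂(u 3) ⋯` : the output of the two-state transducer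
that changes its state after every input letter and outputs the image of the input letter under
`h₁` in the initial state and under `h₂` in the other state. -/
def alternate (h₁ h₂ : α → List β) (hh₁ : ∀ a, h₁ a ≠ []) (hh₂ : ∀ a, h₂ a ≠ []) (u : ℕ → α) :
    ℕ → β :=
  infConcat (fun n => if Even n then h₁ (u n) else h₂ (u n)) (fun n => by
    by_cases hn : Even n
    · simpa [hn] using hh₁ (u n)
    · simpa [hn] using hh₂ (u n))

/-- The factor `u i · u (i + 1) ⋯ u (i + n - 1)` of length `n` of the infinite word `u`. -/
def factorAt (u : ℕ → α) (i n : ℕ) : List α := (List.range n).map fun j => u (i + j)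

/-- The finite word `w` is a factor of the infinite word `u`. -/
def IsFactor (w : List α) (u : ℕ → α) : Prop := ∃ i n : ℕ, w = factorAt u i n

/-- The set of palindromic factors (the empty word included) of the finite word `w`. -/
def palindromicFactors (w : List α) : Set (List α) := {p | p <:+: w ∧ p.Palindrome}

/-- A finite word of length `n` is rich if it has exactly `n + 1` distinct palindromic factors. -/
def FinRich (w : List α) : Prop := (palindromicFactors w).ncard = w.length + 1

/-- An infinite word is rich if all of its finite factors are rich. -/
def InfRich (u : ℕ → α) : Prop := ∀ w : List α, IsFactor w u → FinRich w

/-- The morphism `f`: `0 ↦ 01`, `1 ↦ 022`, `2 ↦ 02`. -/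
def f : Fin 3 → List (Fin 3) := ![[0, 1], [0, 2, 2], [0, 2]]

/-- The morphism `g`: `0 ↦ 20`, `1 ↦ 21`, `2 ↦ 2`. -/
def g : Fin 3 → List (Fin 3) := ![[2, 0], [2, 1], [2]]

/-- The output of the transducer `τ` in its initial state. -/
def t₁ : Fin 3 → List (Fin 3) :=
  ![[0, 0, 1], [0, 0, 1, 0, 1, 1, 0, 1], [0, 0, 1, 0, 1, 1, 0, 1, 0, 0, 1, 0, 1, 1, 0, 1]]

/-- The output of the transducer `τ` in its second state. -/
def t₂ : Fin 3 → List (Fin 3) :=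
  ![[0, 0, 2], [0, 0, 2, 0, 2, 2, 0, 2], [0, 0, 2, 0, 2, 2, 0, 2, 0, 0, 2, 0, 2, 2, 0, 2]]

theorem f_ne_nil (a : Fin 3) : f a ≠ [] := by fin_cases a <;> simp [f]

theorem g_ne_nil (a : Fin 3) : g a ≠ [] := by fin_cases a <;> simp [g]

theorem t₁_ne_nil (a : Fin 3) : t₁ a ≠ [] := by fin_cases a <;> simp [t₁]

theorem t₂_ne_nil (a : Fin 3) : t₂ a ≠ [] := by fin_cases a <;> simp [t₂]

theorem f_prolongable : Prolongable f 0 [1] := by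
  refine ⟨rfl, fun n => ?_⟩
  induction n with
  | zero => simp
  | succ n ih =>
    rw [Function.iterate_succ_apply']
    intro h
    obtain ⟨a, ha⟩ := List.exists_mem_of_ne_nil _ ih
    exact f_ne_nil a (List.flatMap_eq_nil_iff.mp h a ha)

/-- The transducer `τ` on infinite words: `τ(u) = t₁(u 0) t₂(u 1) t₁(u 2) t₂(u 3) ⋯`. -/
def τ : (ℕ → Fin 3) → ℕ → Fin 3 := alternate t₁ t₂ t₁_ne_nil t₂_ne_nil

end RichWords

namespace RichWords

/-! A word is rich once all complete returns to its palindromes are palindromes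
(`infRich_of_returns`), so it suffices to study returns in `z`. Let `v` be the fixed point of `f`.
Only `g 2` has odd length, so the state of the transducer before the image of a letter of `v` is the
parity of the number of preceding letters 2, namely `vst`.

Every `g a` starts with 2. Hence the image of each letter of `v` starts with `t₁ 2` or `t₂ 2`, whose
last 14 letters form a palindromic marker that occurs nowhere else in `z` and reveals the state. The
text between markers reads the same from both sides when the states agree. Therefore a palindrome
with a marker comes from a palindrome `w` of `v` between equal states, with equal margins on both
sides. Its occurrences are those occurrences of `w`, in the same state, whose two neighbouring
letters lie in a set determined by the margin. This turns returns in `z` into flanked returns in `v`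
(`Coding.transfer`).

The word `v` is coded by itself through `f`, with marker 0, and the five sets in `Good` are closed
under the passage to preimages. Induction on length (`retAt_v`) then leaves only factors without 0:
the empty word, 1 and 22. Palindromes of `z` without a marker are shorter than 38; they are settled
by a finite computation (`shortReturns_z`). -/

/-! ### Richness from palindromic complete returns. -/

/-- The factor of `u` between the positions `a` and `b` is a palindrome. -/
def Pal (u : ℕ → Fin 3) (a b : ℕ) : Prop :=
  ∀ s t, a ≤ s → s < b → s + t + 1 = a + b → u s = u t

/-- The factors of length `n` of `u` at the positions `i` and `j` are equal. -/
def Agree (u : ℕ → Fin 3) (i j n : ℕ) : Prop := ∀ t < n, u (i + t) = u (j + t)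

theorem Agree.symm {u : ℕ → Fin 3} {i j n : ℕ} (h : Agree u i j n) : Agree u j i n :=
  fun t ht => (h t ht).symm

theorem Agree.pal {u : ℕ → Fin 3} {i j n : ℕ} (h : Agree u i j n) (hp : Pal u i (i + n)) :
    Pal u j (j + n) := by
  intro s t hs hs' hst
  have h1 := h (s - j) (by omega)
  have h2 := h (t - j) (by omega)
  have h3 := hp (i + (s - j)) (i + (t - j)) (by omega) (by omega) (by omega)
  rw [show j + (s - j) = s by omega] at h1
  rw [show j + (t - j) = t by omega] at h2
  rw [← h1, ← h2, h3]

theorem factorAt_length (u : ℕ → Fin 3) (i n : ℕ) : (factorAt u i n).length = n := by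
  simp [factorAt]

theorem factorAt_eq_iff {u : ℕ → Fin 3} {i j n : ℕ} :
    factorAt u i n = factorAt u j n ↔ Agree u i j n := by
  simp [factorAt, Agree]

theorem factorAt_add {α : Type*} (u : ℕ → α) (i m n : ℕ) :
    factorAt u i (m + n) = factorAt u i m ++ factorAt u (i + m) n := by
  simp only [factorAt, List.range_add, List.map_append, List.map_map]
  congr 1
  apply List.map_congr_left
  intro a _
  simp [add_assoc]

theorem factorAt_palindrome {u : ℕ → Fin 3} {i n : ℕ} :
    (factorAt u i n).Palindrome ↔ Pal u i (i + n) := by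
  rw [List.Palindrome.iff_reverse_eq, List.ext_getElem_iff]
  simp only [List.length_reverse, List.getElem_reverse, true_and, factorAt,
    List.length_map, List.length_range, List.getElem_map, List.getElem_range]
  constructor
  · intro h s t hs hs' hst
    have := h (t - i) (by omega) (by omega)
    rw [show i + (n - 1 - (t - i)) = s by omega, show i + (t - i) = t by omega] at this
    exact this
  · intro h k hk _
    exact h _ _ (by omega) (by omega) (by omega)

theorem infix_factorAt {u : ℕ → Fin 3} {i n : ℕ} {p : List (Fin 3)} :
    p <:+: factorAt u i n ↔ ∃ a k, i ≤ a ∧ a + k ≤ i + n ∧ p = factorAt u a k := by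
  constructor
  · rintro ⟨s, t, h⟩
    have hl := congrArg List.length h
    simp only [List.length_append, factorAt_length] at hl
    refine ⟨i + s.length, p.length, by omega, by omega, ?_⟩
    rw [show n = s.length + (p.length + t.length) by omega, factorAt_add, factorAt_add,
      List.append_assoc] at h
    have h1 := List.append_inj h (by simp [factorAt_length])
    exact (List.append_inj h1.2 (by simp [factorAt_length])).1
  · rintro ⟨a, k, h1, h2, rfl⟩
    refine ⟨factorAt u i (a - i), factorAt u (a + k) (i + n - (a + k)), ?_⟩
    have h3 := factorAt_add u i (a - i) (k + (i + n - (a + k)))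
    rw [show i + (a - i) = a by omega, factorAt_add u a k,
      show a - i + (k + (i + n - (a + k))) = n by omega] at h3
    rw [h3, List.append_assoc]

/-- If the complete returns to palindromes in `u` are palindromes, then `u` is rich. -/
theorem infRich_of_returns {u : ℕ → Fin 3}
    (h : ∀ i j n, i < j → Pal u i (i + n) → Agree u i j n →
      (∀ k, i < k → k < j → ¬ Agree u i k n) → Pal u i (j + n)) : InfRich u := by
  rintro w ⟨i, n, rfl⟩
  have key : (palindromicFactors (factorAt u i n)).Finite ∧
      (palindromicFactors (factorAt u i n)).ncard = n + 1 := by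
    induction n with
    | zero =>
      have : palindromicFactors (factorAt u i 0) = {[]} := by
        ext p
        simp only [palindromicFactors, factorAt, List.range_zero, List.map_nil, List.infix_nil,
          Set.mem_ofPred_eq, Set.mem_singleton_iff, and_iff_left_iff_imp]
        rintro rfl
        exact List.Palindrome.nil
      rw [this]
      simp
    | succ n ih =>
      -- The least such `a` starts the longest palindromic suffix, the only palindrome that the new
      -- letter contributes.
      have hex : ∃ a, i ≤ a ∧ a ≤ i + n ∧ Pal u a (i + n + 1) :=
        ⟨i + n, by omega, le_rfl, fun s t h1 h2 h3 => by
          rw [show s = t by omega]⟩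
      classical
      obtain ⟨ha1, ha2, ha3⟩ := Nat.find_spec hex
      have hmin := fun k => @Nat.find_min _ _ hex k
      set a := Nat.find hex
      have hins : palindromicFactors (factorAt u i (n + 1)) =
          insert (factorAt u a (i + n + 1 - a)) (palindromicFactors (factorAt u i n)) := by
        ext p
        simp only [palindromicFactors, Set.mem_ofPred_eq, Set.mem_insert_iff, infix_factorAt]
        constructor
        · rintro ⟨⟨b, k, hb1, hb2, rfl⟩, hp⟩
          rw [factorAt_palindrome] at hp
          rcases Nat.lt_or_ge (i + n) (b + k) with hlt | hge
          · obtain hbk : b + k = i + n + 1 := by omega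
            rcases Nat.eq_or_lt_of_le hb2 with _ | _
            swap
            · omega
            rcases Nat.lt_trichotomy a b with hab | hab | hab
            · right
              -- A shorter palindromic suffix is mirrored to a prefix of the longest one, so it
              -- already occurs without the new letter.
              refine ⟨⟨a, k, ha1, by omega, ?_⟩, factorAt_palindrome.mpr hp⟩
              rw [factorAt_eq_iff]
              intro t ht
              have e1 := hp (b + t) (b + (k - 1 - t)) (by omega) (by omega) (by omega)
              have e2 := ha3 (b + (k - 1 - t)) (a + t) (by omega) (by omega) (by omega)
              rw [e1, e2]
            · left
              subst hab
              rw [show i + n + 1 - a = k by omega]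
            · exfalso
              rcases Nat.eq_zero_or_pos k with hk | hk
              · omega
              · exact hmin b hab ⟨hb1, by omega, by rw [← hbk]; exact hp⟩
          · exact Or.inr ⟨⟨b, k, hb1, hge, rfl⟩, factorAt_palindrome.mpr hp⟩
        · rintro (rfl | ⟨⟨b, k, hb1, hb2, rfl⟩, hp⟩)
          · refine ⟨⟨a, _, ha1, by omega, rfl⟩, factorAt_palindrome.mpr ?_⟩
            rwa [show a + (i + n + 1 - a) = i + n + 1 by omega]
          · exact ⟨⟨b, k, hb1, by omega, rfl⟩, hp⟩
      have hnot : factorAt u a (i + n + 1 - a) ∉ palindromicFactors (factorAt u i n) := by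
        rintro ⟨hp, -⟩
        obtain ⟨b, k, hb1, hb2, hb⟩ := infix_factorAt.mp hp
        have hk := congrArg List.length hb
        simp only [factorAt_length] at hk
        subst hk
        -- The least `d` leads to the nearest earlier occurrence. The complete return starting there
        -- would be a longer palindromic suffix, against the choice of `a`.
        have hQ : ∃ d, i ≤ a - d ∧ 0 < d ∧ d ≤ a ∧ Agree u (a - d) a (i + n + 1 - a) := by
          refine ⟨a - b, by omega, by omega, by omega, ?_⟩
          rw [show a - (a - b) = b by omega]
          exact (factorAt_eq_iff.mp hb).symm
        obtain ⟨hd1, hd2, hd3, hd4⟩ := Nat.find_spec hQ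
        have hdm := fun k => @Nat.find_min _ _ hQ k
        set d := Nat.find hQ
        refine hmin (a - d) (by omega) ⟨hd1, by omega, ?_⟩
        have := h (a - d) a (i + n + 1 - a) (by omega)
          (hd4.symm.pal (by rwa [show a + (i + n + 1 - a) = i + n + 1 by omega])) hd4 ?_
        · rwa [show a + (i + n + 1 - a) = i + n + 1 by omega] at this
        · intro k hk1 hk2 hk3
          refine hdm (a - k) (by omega) ⟨by omega, by omega, by omega, ?_⟩
          rw [show a - (a - k) = k by omega]
          exact fun t ht => (hk3 t ht).symm.trans (hd4 t ht)
      rw [hins]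
      exact ⟨ih.1.insert _, by rw [Set.ncard_insert_of_notMem hnot ih.1, ih.2]⟩
  rw [FinRich, key.2, factorAt_length]

/-! ### Returns restricted by states and neighbouring letters. -/

/-- The letters around the factor of length `n` of `u` at the position `i` belong to `S`. If the
factor has no letter before it, then `S` has to contain all letters. -/
def Flank (S : Fin 3 → Bool) (u : ℕ → Fin 3) (i n : ℕ) : Prop :=
  S (u (i + n)) = true ∧ (i = 0 → ∀ a, S a = true) ∧ ∀ k, k + 1 = i → S (u k) = true

/-- The sequence of states `st` is produced by an automaton reading `u`, in which every letter acts
as an involution. -/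
structure Tracks (nx : Fin 3 → Bool → Bool) (u : ℕ → Fin 3) (st : ℕ → Bool) : Prop where
  step : ∀ k, st (k + 1) = nx (u k) (st k)
  invol : ∀ a c, nx a (nx a c) = c

/-- Let `p` be the factor of length `n` of `u` at the position `i`. If `p` is a palindrome between
two equal states, with both adjacent letters in `S`, then the complete return to `p` at the position
`i`, with respect to occurrences of `p` that start in the same state and have both adjacent letters
in `S`, is a palindrome. -/
def RetAt (u : ℕ → Fin 3) (st : ℕ → Bool) (S : Fin 3 → Bool) (n i : ℕ) : Prop :=
  ∀ j, i < j → st j = st i → Pal u i (i + n) → st (i + n) = st i → Agree u i j n →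
    Flank S u i n → Flank S u j n →
    (∀ k, i < k → k < j → st k = st i → Agree u i k n → ¬ Flank S u k n) → Pal u i (j + n)

section Tracks

variable {nx : Fin 3 → Bool → Bool} {u : ℕ → Fin 3} {st : ℕ → Bool}

theorem Tracks.back (h : Tracks nx u st) (k : ℕ) : st k = nx (u k) (st (k + 1)) := by
  rw [h.step, h.invol]

theorem Tracks.shift (h : Tracks nx u st) {i j n : ℕ} (hs : st i = st j) (ha : Agree u i j n) :
    ∀ t ≤ n, st (i + t) = st (j + t) := by
  intro t
  induction t with
  | zero => simpa using hs
  | succ t ih =>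
    intro ht
    rw [← add_assoc, ← add_assoc, h.step, h.step, ih (by omega), ha t (by omega)]

theorem Tracks.shift_back (h : Tracks nx u st) {i j n : ℕ} (hs : st (i + n) = st (j + n))
    (ha : Agree u i j n) : st i = st j := by
  induction n with
  | zero => simpa using hs
  | succ n ih =>
    refine ih ?_ (fun t ht => ha t (by omega))
    rw [h.back (i + n), h.back (j + n), ha n (by omega), add_assoc, hs, add_assoc]

/-- Since letters act as involutions, reading a letter forwards from the left end and its mirror
image backwards from the right end changes the state in the same way. -/
theorem Tracks.reflect (h : Tracks nx u st) {i j : ℕ} (hs : st i = st j) (hp : Pal u i j) :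
    ∀ s t, i ≤ s → s ≤ j → s + t = i + j → st s = st t := by
  intro s t hs1 hs2 hst
  obtain ⟨d, rfl⟩ := Nat.exists_eq_add_of_le hs1
  clear hs1
  induction d generalizing t with
  | zero => rw [show t = j by omega]; simpa using hs
  | succ d ih =>
    rw [← add_assoc, h.step, ih (t + 1) (by omega) (by omega), h.back t,
      hp (i + d) t (by omega) (by omega) (by omega)]

/-- If the flanked occurrences of a palindrome are those of one longer palindrome, shifted by `d`,
then the complete returns differ only by `d` letters at each end. This replaces short factors
without a marker by factors that contain one. -/
theorem retAt_of_extension (h : Tracks nx u st) {S : Fin 3 → Bool} {n i d : ℕ} (hdi : d ≤ i)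
    (hpal : Pal u (i - d) (i + n + d))
    (h1 : ∀ k, Agree u i k n → Flank S u k n → d ≤ k ∧ Agree u (i - d) (k - d) (n + 2 * d))
    (h2 : ∀ k, i < k → Agree u (i - d) (k - d) (n + 2 * d) → Flank S u k n)
    (hret : RetAt u st (fun _ => true) (n + 2 * d) (i - d)) : RetAt u st S n i := by
  intro j hij hst hp hst' ha _ hFj hno
  obtain ⟨hdj, haj⟩ := h1 j ha hFj
  have e1 : i - d + (n + 2 * d) = i + n + d := by omega
  have hst'' : st (i - d) = st (i + n + d) := by
    have key : ∀ e ≤ d, st (i - e) = st (i + n + e) := by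
      intro e
      induction e with
      | zero => intro _; simpa using hst'.symm
      | succ e ih =>
        intro he
        rw [← add_assoc, h.step, ← ih (by omega), h.back (i - (e + 1)),
          show i - (e + 1) + 1 = i - e by omega]
        rw [hpal (i - (e + 1)) (i + n + e) (by omega) (by omega) (by omega)]
    exact key d le_rfl
  have hback : ∀ k, d ≤ k → st k = st i → Agree u (i - d) (k - d) (n + 2 * d) →
      st (k - d) = st (i - d) := fun k hk hs hag => by
    refine h.shift_back (n := d) ?_ (fun t ht => (hag t (by omega)).symm)
    rwa [show k - d + d = k by omega, show i - d + d = i by omega]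
  have hfl : ∀ k m, Flank (fun _ => true) u k m := fun k m => ⟨rfl, fun _ _ => rfl, fun _ _ => rfl⟩
  have := hret (j - d) (by omega) (hback j hdj hst haj) (by rwa [e1])
    (by rw [e1]; exact hst''.symm) haj (hfl _ _) (hfl _ _) ?_
  · exact fun s t q1 q2 q3 => this s t (by omega) (by omega) (by omega)
  · intro k hk1 hk2 hk3 hk4 _
    have hag : Agree u i (k + d) n := fun t ht => by
      have := hk4 (d + t) (by omega)
      rwa [show i - d + (d + t) = i + t by omega, ← add_assoc] at this
    refine hno (k + d) (by omega) (by omega) ?_ hag (h2 _ (by omega) (by simpa using hk4))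
    have := h.shift hk3.symm hk4 d (by omega)
    rw [← this, show i - d + d = i by omega]

end Tracks

/-! ### Codings by palindromic markers and the transfer of returns. -/

/-- The word `U` with states `stU` is the image of the word `v` with states `st`: the letter `v k`
corresponds to the part of `U` between the positions `P k` and `P (k + 1)`; at the positions `P k`
occur markers of length `m`, which are palindromes; and reading `U` from the end of the marker at
`P k` until the end of the next marker, or from the beginning of the marker at `P (k + 1)` back to
the beginning of the preceding marker, one reads the word `str (v k)`, with the current state as
parameter. -/
structure Coding (nx : Fin 3 → Bool → Bool) (v : ℕ → Fin 3) (st : ℕ → Bool)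
    (nxU : Fin 3 → Bool → Bool) (U : ℕ → Fin 3) (stU : ℕ → Bool) (P : ℕ → ℕ) (m : ℕ)
    (len : Fin 3 → ℕ) (str : Fin 3 → Bool → ℕ → Fin 3) : Prop where
  tr : Tracks nx v st
  trU : Tracks nxU U stU
  step : ∀ k, P (k + 1) = P k + len (v k)
  fwd : ∀ k, ∀ t < len (v k), U (P k + m + t) = str (v k) (st k) t
  bwd : ∀ k, ∀ t < len (v k), ∀ s, s + t + 1 = P (k + 1) → U s = str (v k) (st (k + 1)) t
  m_pos : 0 < m
  m_le : ∀ a, m ≤ len a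
  mark_pal : ∀ k, Pal U (P k) (P k + m)
  recog : ∀ s k, Agree U (P k) s m → ∃ k', s = P k'
  recog_st : ∀ k k', Agree U (P k) (P k') m → stU (P k) = stU (P k') → st k = st k'
  mark_agree : ∀ k k', st k = st k' → Agree U (P k) (P k') m
  st_agree : ∀ k k', st k = st k' → stU (P k) = stU (P k')
  mark_st : ∀ k, stU (P k + m) = stU (P k)
  dec : ∀ a b c, (∀ t, t < len a → t < len b → str a c t = str b c t) → a = b

/-- The letters whose image begins like that of `b`, up to the length `l`, and continues with a
letter of `T`. -/
def extLetters (len : Fin 3 → ℕ) (str : Fin 3 → Bool → ℕ → Fin 3) (T : Fin 3 → Bool) (l : ℕ)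
    (b : Fin 3) (c : Bool) : Fin 3 → Bool :=
  fun a => decide (l < len a ∧ (∀ t < l, str a c t = str b c t) ∧ T (str a c l) = true)

namespace Coding

variable {nx nxU : Fin 3 → Bool → Bool} {v U : ℕ → Fin 3} {st stU : ℕ → Bool} {P : ℕ → ℕ} {m : ℕ}
  {len : Fin 3 → ℕ} {str : Fin 3 → Bool → ℕ → Fin 3}
  (C : Coding nx v st nxU U stU P m len str)
include C

theorem len_pos (a : Fin 3) : 0 < len a := C.m_pos.trans_le (C.m_le a)

theorem strictMono : StrictMono P :=
  strictMono_nat_of_lt_succ fun k => by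
    have := C.len_pos (v k)
    rw [C.step]; omega

theorem le_sub (i n : ℕ) : P i + n ≤ P (i + n) := by
  induction n with
  | zero => simp
  | succ n ih =>
    have := C.strictMono (show i + n < i + (n + 1) by omega)
    omega

/-- Palindromes are mapped to palindromes. -/
theorem pal_image : ∀ n i, Pal v i (i + n) → st i = st (i + n) →
    Pal U (P i) (P (i + n) + m)
  | 0, i, _, _ => C.mark_pal i
  | 1, i, _, hs => by
    have key : ∀ s t, P i + m ≤ s → s < P (i + 1) + m → s + t + 1 = P i + (P (i + 1) + m) →
        U s = U t := by
      intro s t h1 h2 h3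
      have h4 := C.step i
      have e1 := C.fwd i (s - P i - m) (by omega)
      have e2 := C.bwd i (s - P i - m) (by omega) t (by omega)
      rw [show P i + m + (s - P i - m) = s by omega] at e1
      rw [e1, e2, hs]
    intro s t h1 h2 h3
    have h4 := C.step i
    have h5 := C.m_le (v i)
    rcases Nat.lt_or_ge s (P i + m) with h | h
    · exact (key t s (by omega) (by omega) (by omega)).symm
    · exact key s t h h2 h3
  | n + 2, i, hp, hs => by
    have hr := C.tr.reflect hs hp
    have hs' : st (i + 1) = st (i + 1 + n) := hr (i + 1) (i + 1 + n) (by omega) (by omega) (by omega)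
    have ih := pal_image n (i + 1) (fun s t h1 h2 h3 => hp s t (by omega) (by omega) (by omega)) hs'
    have hv : v i = v (i + 1 + n) := hp i (i + 1 + n) le_rfl (by omega) (by omega)
    have q1 := C.step i
    have q2 := C.step (i + 1 + n)
    rw [show i + 1 + n + 1 = i + (n + 2) by omega] at q2
    have q3 := C.le_sub (i + 1) n
    -- The image of the first letter read backwards and that of the last letter read forwards are
    -- the same `str`, for the same letter and the same state.
    have key : ∀ s t, P i ≤ s → s < P (i + 1) → s + t + 1 = P i + (P (i + (n + 2)) + m) →
        U s = U t := by
      intro s t h1 h2 h3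
      have e1 := C.bwd i (P (i + 1) - 1 - s) (by omega) s (by omega)
      have e2 := C.fwd (i + 1 + n) (P (i + 1) - 1 - s) (by rw [← hv]; omega)
      rw [show P (i + 1 + n) + m + (P (i + 1) - 1 - s) = t by rw [← hv] at q2; omega] at e2
      rw [e1, e2, hv, hs']
    intro s t h1 h2 h3
    rw [← hv] at q2
    rcases Nat.lt_or_ge s (P (i + 1)) with h | h
    · exact key s t h1 h h3
    · rcases Nat.lt_or_ge s (P (i + 1 + n) + m) with h' | h'
      · exact ih s t h h' (by omega)
      · exact (key t s (by omega) (by omega) (by omega)).symm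

/-- Equal factors are mapped to equal factors. -/
theorem agree_image {i k n : ℕ} (hs : st i = st k) (ha : Agree v i k n) :
    P (i + n) + P k = P (k + n) + P i ∧ Agree U (P i) (P k) (P (i + n) - P i + m) := by
  induction n with
  | zero =>
    refine ⟨by simp [add_comm], ?_⟩
    simpa using C.mark_agree i k hs
  | succ n ih =>
    obtain ⟨h1, h2⟩ := ih fun t ht => ha t (by omega)
    have hst := C.tr.shift hs ha n (by omega)
    have hv := ha n (by omega)
    have q1 := C.step (i + n)
    have q2 := C.step (k + n)
    have q3 := C.le_sub i n
    rw [← add_assoc, ← add_assoc]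
    refine ⟨by rw [q1, q2, hv]; omega, fun t ht => ?_⟩
    rcases Nat.lt_or_ge t (P (i + n) - P i + m) with h | h
    · exact h2 t h
    · have e1 := C.fwd (i + n) (t - (P (i + n) - P i + m)) (by omega)
      have e2 := C.fwd (k + n) (t - (P (i + n) - P i + m)) (by rw [← hv]; omega)
      rw [show P (i + n) + m + (t - (P (i + n) - P i + m)) = P i + t by omega] at e1
      rw [show P (k + n) + m + (t - (P (i + n) - P i + m)) = P k + t by omega] at e2
      rw [e1, e2, hv, hst]

/-- Factors are determined by their images. -/
theorem agree_of_image {i j n : ℕ} (hs : st i = st j)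
    (ha : Agree U (P i) (P j) (P (i + n) - P i + m)) :
    Agree v i j n ∧ P (i + n) + P j = P (j + n) + P i := by
  induction n with
  | zero => exact ⟨fun t ht => absurd ht (by omega), by simp [add_comm]⟩
  | succ n ih =>
    have q1 := C.step (i + n)
    have q2 := C.step (j + n)
    have q3 := C.le_sub i n
    rw [← add_assoc] at ha
    obtain ⟨h1, h2⟩ := ih fun t ht => ha t (by omega)
    have hst := C.tr.shift hs h1 n le_rfl
    have hv : v (i + n) = v (j + n) := by
      refine C.dec _ _ (st (i + n)) fun t ht1 ht2 => ?_
      have e1 := C.fwd (i + n) t ht1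
      have e2 := C.fwd (j + n) t ht2
      rw [← e1, hst, ← e2]
      have := ha (P (i + n) - P i + m + t) (by omega)
      rwa [show P i + (P (i + n) - P i + m + t) = P (i + n) + m + t by omega,
        show P j + (P (i + n) - P i + m + t) = P (j + n) + m + t by omega] at this
    refine ⟨fun t ht => ?_, by rw [← add_assoc, ← add_assoc, q1, q2, hv]; omega⟩
    rcases Nat.lt_or_ge t n with h | h
    · exact h1 t h
    · rw [show t = n by omega, hv]

/-- A factor whose image is a palindrome is a palindrome. -/
theorem pal_of_image : ∀ n i, st i = st (i + n) → Pal U (P i) (P (i + n) + m) → Pal v i (i + n)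
  | 0, i, _, _ => fun s t h1 h2 h3 => by omega
  | 1, i, _, _ => fun s t h1 h2 h3 => by rw [show s = t by omega]
  | n + 2, i, hs, hp => by
    have q1 := C.step i
    have q2 := C.step (i + 1 + n)
    have q3 := C.le_sub (i + 1) n
    rw [show i + 1 + n + 1 = i + (n + 2) by omega] at q2
    have hv : v i = v (i + 1 + n) := by
      refine C.dec _ _ (st i) fun t ht1 ht2 => ?_
      have e1 := C.fwd i t ht1
      have e2 := C.bwd (i + 1 + n) t ht2 (P (i + (n + 2)) - 1 - t)
        (by rw [show i + 1 + n + 1 = i + (n + 2) by omega]; omega)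
      rw [← e1, hs, show i + (n + 2) = i + 1 + n + 1 by omega, ← e2]
      exact hp _ _ (by omega) (by omega) (by omega)
    have hs' : st (i + 1) = st (i + 1 + n) := by
      rw [C.tr.step, C.tr.back (i + 1 + n), hv, hs, show i + 1 + n + 1 = i + (n + 2) by omega]
    have ih := pal_of_image n (i + 1) hs' (fun s t h1 h2 h3 =>
      hp s t (by omega) (by omega) (by rw [hv] at q1; omega))
    intro s t h1 h2 h3
    rcases Nat.eq_or_lt_of_le h1 with h | h
    · rw [← h, hv, show t = i + 1 + n by omega]
    · rcases Nat.lt_or_ge s (i + 1 + n) with h' | h'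
      · exact ih s t h h' (by omega)
      · rw [show s = i + 1 + n by omega, show t = i by omega, hv]

/-- By `dec` the words `str a c` form a prefix code: one that agrees with `str b c` as far as both
are compared cannot end before `str b c` does. -/
theorem lt_len_of_agree {l : ℕ} {a b : Fin 3} {c : Bool} (hl : l < len b)
    (h : ∀ t, t < l → t < len a → str a c t = str b c t) : l < len a := by
  by_contra hcon
  have := C.dec a b c fun t h1 _ => h t (by omega) h1
  rw [this] at hcon
  exact hcon hl

/-- Complete returns in the image to palindromes that contain a marker are palindromes, if complete
returns to shorter palindromes in the preimage are. -/
theorem transfer {T : Fin 3 → Bool} {I N : ℕ}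
    (hP0 : P 0 = 0 ∨ (∀ a, T a = true) ∧
      ∀ a b c, P 0 < len a ∧ ∀ t < P 0, str a c t = str b c t)
    (hret : ∀ n l i, P i = I + l → P (i + n) + m + l = I + N → l < len (v (i + n)) →
      T (str (v (i + n)) (st i) l) = true →
      RetAt v st (extLetters len str T l (v (i + n)) (st i)) n i)
    (hmark : ∃ k, I ≤ P k ∧ P k + m ≤ I + N) :
    RetAt U stU T N I := by
  intro J hIJ hst hp hst' ha hI hJ hno
  classical
  have hmono := C.strictMono
  obtain ⟨k₀, hk₀, hk₀'⟩ := hmark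
  -- the first and the last marker
  have hex : ∃ k, I ≤ P k := ⟨k₀, hk₀⟩
  obtain ⟨i, hi, himin⟩ : ∃ i, I ≤ P i ∧ ∀ k < i, P k < I :=
    ⟨Nat.find hex, Nat.find_spec hex, fun k hk => not_le.mp (Nat.find_min hex hk)⟩
  have hex' : ∃ k, I + N < P k + m := ⟨I + N, by
    have h1 := C.le_sub 0 (I + N)
    have h2 := C.m_pos
    rw [zero_add] at h1
    omega⟩
  obtain ⟨e, he, hemin⟩ : ∃ e, I + N < P e + m ∧ ∀ k < e, P k + m ≤ I + N :=
    ⟨Nat.find hex', Nat.find_spec hex', fun k hk => not_lt.mp (Nat.find_min hex' hk)⟩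
  have hik₀ : i ≤ k₀ := by
    by_contra hcon
    have := himin k₀ (by omega)
    omega
  have hk₀e : k₀ < e := by
    by_contra hcon
    have := hmono.monotone (show e ≤ k₀ by omega)
    omega
  obtain ⟨n, rfl⟩ : ∃ n, e = i + n + 1 := ⟨e - i - 1, by omega⟩
  have hn := hemin (i + n) (by omega)
  -- markers are reflected to markers
  have hrefl : ∀ k, I ≤ P k → P k + m ≤ I + N → ∃ k', P k' + P k + m = I + (I + N) := by
    intro k hk hk'
    obtain ⟨k', hk''⟩ := C.recog (I + (I + N) - m - P k) k fun t ht => by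
      rw [C.mark_pal k (P k + t) (P k + (m - 1 - t)) (by omega) (by omega) (by omega)]
      exact hp _ _ (by omega) (by omega) (by omega)
    exact ⟨k', by omega⟩
  have hsum : P i + P (i + n) + m = I + (I + N) := by
    obtain ⟨a, ha'⟩ := hrefl i hi ((Nat.add_le_add_right
      (hmono.monotone (show i ≤ i + n by omega)) m).trans hn)
    obtain ⟨b, hb'⟩ := hrefl (i + n) (hi.trans (hmono.monotone (by omega))) hn
    have h1 : a ≤ i + n := by
      by_contra hcon
      have := hmono.monotone (show i + n + 1 ≤ a by omega)
      omega
    have h2 : i ≤ b := by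
      by_contra hcon
      have := himin b (by omega)
      omega
    have h3 := hmono.monotone h1
    have h4 := hmono.monotone h2
    omega
  -- By `hsum` the margins outside the first and last markers have the same length `l`. The right
  -- one is a proper prefix of the image of a single letter, the left one its mirror image.
  obtain ⟨l, hl⟩ : ∃ l, P i = I + l := Nat.exists_eq_add_of_le hi
  have hl' : P (i + n) + m + l = I + N := by omega
  have hsub := C.le_sub i n
  have hNl : N = P (i + n) - P i + m + l + l := by omega
  have hlb : l < len (v (i + n)) := by
    have := C.step (i + n)
    omega
  -- states
  have hstI : stU (P i) = stU (P (i + n)) := by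
    rw [← C.mark_st (i + n)]
    exact C.trU.reflect hst'.symm hp _ _ hi (by omega) (by omega)
  have hsti : st i = st (i + n) := by
    refine C.recog_st _ _ (fun t ht => ?_) hstI
    rw [hp (P i + t) (P (i + n) + (m - 1 - t)) (by omega) (by omega) (by omega)]
    exact (C.mark_pal (i + n) _ _ (by omega) (by omega) (by omega)).symm
  have hpv : Pal v i (i + n) := C.pal_of_image n i hsti fun s t h1 h2 h3 =>
    hp s t (by omega) (by omega) (by omega)
  -- the second occurrence
  obtain ⟨j, hj⟩ : ∃ j, J + l = P j := C.recog (J + l) i fun t ht => by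
    rw [hl, add_assoc, add_assoc]
    exact ha (l + t) (by omega)
  have hagreeP : Agree U (P i) (P j) (P (i + n) - P i + m) := fun t ht => by
    rw [hl, ← hj, add_assoc, add_assoc]
    exact ha (l + t) (by omega)
  have hstj : st i = st j := by
    refine C.recog_st _ _ (fun t ht => hagreeP t (by omega)) ?_
    rw [hl, ← hj]
    exact C.trU.shift hst.symm ha l (by omega)
  obtain ⟨hagree, hPj⟩ := C.agree_of_image hstj hagreeP
  have hij : i < j := by
    rw [← hmono.lt_iff_lt]
    omega
  have hstjn : st (i + n) = st (j + n) := C.tr.shift hstj hagree n le_rfl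
  -- the letters after the last marker
  have hright : ∀ t < l, U (P (i + n) + m + t) = str (v (i + n)) (st i) t := fun t ht => by
    rw [C.fwd _ t (by omega), hsti]
  have hleft : ∀ t < l, ∀ s, s + t + 1 = P i → U s = str (v (i + n)) (st i) t :=
    fun t ht s hs => by
      rw [← hright t ht]
      exact hp _ _ (by omega) (by omega) (by omega)
  have hTb : T (str (v (i + n)) (st i) l) = true := by
    rw [hsti, ← C.fwd _ l hlb, hl']
    exact hI.1
  have hext : ∀ a, extLetters len str T l (v (i + n)) (st i) a = true ↔
      l < len a ∧ (∀ t < l, str a (st i) t = str (v (i + n)) (st i) t) ∧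
        T (str a (st i) l) = true := fun a => by
    simp only [extLetters, decide_eq_true_eq]
  have hFi : Flank (extLetters len str T l (v (i + n)) (st i)) v i n := by
    refine ⟨(hext _).mpr ⟨hlb, fun _ _ => rfl, hTb⟩, fun hi0 a => ?_, fun k hk => ?_⟩
    -- No letter precedes `v 0`, so `Flank` requires the full alphabet. This is where `hP0` enters:
    -- a margin before the first marker must not distinguish letters.
    · rw [hi0] at hl
      rcases hP0 with h0 | ⟨h1, h2⟩
      · have hl0 : l = 0 := by omega
        refine (hext a).mpr ⟨hl0 ▸ C.len_pos a, by omega, ?_⟩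
        exact hI.2.1 (by omega) _
      · exact (hext a).mpr ⟨by have := (h2 a a true).1; omega,
          fun t ht => (h2 a (v (i + n)) (st i)).2 t (by omega), h1 _⟩
    · subst hk
      have hbw := C.bwd k
      have hlt : l < len (v k) := C.lt_len_of_agree (c := st (k + 1)) hlb fun t ht1 ht2 => by
        rw [← hbw t ht2 (P (k + 1) - 1 - t) (by omega)]
        exact hleft t ht1 _ (by omega)
      have hkI := himin k (by omega)
      refine (hext _).mpr ⟨hlt, fun t ht => ?_, ?_⟩
      · rw [← hbw t (by omega) (P (k + 1) - 1 - t) (by omega)]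
        exact hleft t ht _ (by omega)
      · rw [← hbw l hlt (I - 1) (by omega)]
        exact hI.2.2 _ (by omega)
  have hFj : Flank (extLetters len str T l (v (i + n)) (st i)) v j n := by
    have hPj' : P (j + n) + m + l = J + N := by omega
    refine ⟨?_, fun h0 => by omega, fun k hk => ?_⟩
    · have hr : ∀ t < l, t < len (v (j + n)) →
          str (v (j + n)) (st i) t = str (v (i + n)) (st i) t := fun t ht1 ht2 => by
        rw [← hright t ht1, hsti, hstjn, ← C.fwd _ t ht2]
        have := ha (P (i + n) + m + t - I) (by omega)
        rw [show I + (P (i + n) + m + t - I) = P (i + n) + m + t by omega,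
          show J + (P (i + n) + m + t - I) = P (j + n) + m + t by omega] at this
        exact this.symm
      have hlt := C.lt_len_of_agree hlb hr
      refine (hext _).mpr ⟨hlt, fun t ht => hr t ht (by omega), ?_⟩
      rw [hsti, hstjn, ← C.fwd _ l hlt, hPj']
      exact hJ.1
    · subst hk
      have hr : ∀ t < l, t < len (v k) →
          str (v k) (st i) t = str (v (i + n)) (st i) t := fun t ht1 ht2 => by
        rw [hstj, ← C.bwd k t ht2 (P (k + 1) - 1 - t) (by omega), ← hstj,
          ← hleft t ht1 (P i - 1 - t) (by omega)]
        have := ha (l - 1 - t) (by omega)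
        rw [show I + (l - 1 - t) = P i - 1 - t by omega,
          show J + (l - 1 - t) = P (k + 1) - 1 - t by omega] at this
        exact this.symm
      have hlt := C.lt_len_of_agree hlb hr
      refine (hext _).mpr ⟨hlt, fun t ht => hr t ht (by omega), ?_⟩
      have hkstep := C.step k
      rw [hstj, ← C.bwd k l hlt (J - 1) (by omega)]
      exact hJ.2.2 _ (by omega)
  have hres := hret n l i hl hl' hlb hTb j hij hstj.symm hpv
    hsti.symm hagree hFi hFj ?_
  -- The image of the palindromic return in `v` covers everything except the two outer margins;
  -- these mirror each other because the palindrome recurs at `J`.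
  · have hpim := C.pal_image (j - i + n) i (by rwa [show i + (j - i + n) = j + n by omega])
      (by rw [show i + (j - i + n) = j + n by omega, hsti, hstjn])
    rw [show i + (j - i + n) = j + n by omega] at hpim
    have hout : ∀ s t, I ≤ s → s < P i → s + t + 1 = I + (J + N) → U s = U t := by
      intro s t h1 h2 h3
      rw [hp s (I + (t - J)) h1 (by omega) (by omega)]
      have := ha (t - J) (by omega)
      rwa [show J + (t - J) = t by omega] at this
    intro s t h1 h2 h3
    rcases Nat.lt_or_ge s (P i) with h | h
    · exact hout s t h1 h h3
    · rcases Nat.lt_or_ge s (P (j + n) + m) with h' | h'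
      · exact hpim s t h h' (by omega)
      · exact (hout t s (by omega) (by omega) (by omega)).symm
  · intro k hik hkj hstk hak hFk
    -- An intermediate flanked occurrence in `v` would give an occurrence in `U` starting `l`
    -- letters before its first marker, which `hno` excludes.
    obtain ⟨k, rfl⟩ : ∃ k', k = k' + 1 := ⟨k - 1, by omega⟩
    obtain ⟨r1, r2, r3⟩ := (hext _).mp hFk.1
    obtain ⟨q1, q2, q3⟩ := (hext _).mp (hFk.2.2 k rfl)
    obtain ⟨g1, g2⟩ := C.agree_image hstk.symm hak
    have hkstep := C.step k
    have hkm1 := hmono hik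
    have hkm2 := hmono hkj
    have hstkn : st (k + 1 + n) = st i := by
      rw [← C.tr.shift hstk.symm hak n le_rfl, hsti]
    have hA : Agree U I (P (k + 1) - l) N := by
      intro t ht
      rcases Nat.lt_or_ge t l with h | h
      · rw [hleft (l - 1 - t) (by omega) _ (by omega), ← q2 (l - 1 - t) (by omega), ← hstk]
        exact (C.bwd k _ (by omega) _ (by omega)).symm
      · rcases Nat.lt_or_ge t (l + (P (i + n) - P i + m)) with h' | h'
        · have := g2 (t - l) (by omega)
          rwa [show P i + (t - l) = I + t by omega,
            show P (k + 1) + (t - l) = P (k + 1) - l + t by omega] at this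
        · have e1 := hright (t - l - (P (i + n) - P i + m)) (by omega)
          have e2 := C.fwd (k + 1 + n) (t - l - (P (i + n) - P i + m)) (by omega)
          rw [show P (i + n) + m + (t - l - (P (i + n) - P i + m)) = I + t by omega] at e1
          rw [show P (k + 1 + n) + m + (t - l - (P (i + n) - P i + m)) =
            P (k + 1) - l + t by omega, hstkn, r2 _ (by omega)] at e2
          rw [e1, e2]
    refine hno (P (k + 1) - l) (by omega) (by omega) ?_ hA ⟨?_, by omega, fun K hK => ?_⟩
    · refine C.trU.shift_back (n := l) ?_ (fun t ht => (hA t (by omega)).symm)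
      rw [show P (k + 1) - l + l = P (k + 1) by omega, ← hl]
      exact C.st_agree _ _ hstk
    · rw [show P (k + 1) - l + N = P (k + 1 + n) + m + l by omega, C.fwd _ l r1, hstkn]
      exact r3
    · rw [C.bwd k l q1 K (by omega), hstk]
      exact q3

end Coding

/-! ### Prefixes of the fixed point and of its image under the transducer. -/

/-- The finite word `l` is a prefix of the infinite word `u`. -/
def IsPrefixOf {α : Type*} (l : List α) (u : ℕ → α) : Prop := factorAt u 0 l.length = l

theorem isPrefixOf_factorAt {α : Type*} (u : ℕ → α) (n : ℕ) : IsPrefixOf (factorAt u 0 n) u := by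
  simp [IsPrefixOf, factorAt]

theorem IsPrefixOf.of_append {α : Type*} {u : ℕ → α} {l l' : List α} (h : IsPrefixOf (l ++ l') u) :
    IsPrefixOf l u ∧ factorAt u l.length l'.length = l' := by
  rw [IsPrefixOf, List.length_append, factorAt_add] at h
  have := List.append_inj h (by simp [factorAt])
  exact ⟨this.1, by simpa using this.2⟩

theorem getElem?_factorAt {α : Type*} (u : ℕ → α) {i n t : ℕ} (ht : t < n) :
    (factorAt u i n)[t]? = some (u (i + t)) := by
  simp [factorAt, ht]

theorem isPrefixOf_infConcat {α : Type*} (b : ℕ → List α) (hb : ∀ n, b n ≠ []) (n : ℕ) :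
    IsPrefixOf ((List.range n).flatMap b) (infConcat b hb) := by
  have hpre : ∀ m k, (List.range m).flatMap b <+: (List.range (m + k)).flatMap b := fun m k => by
    rw [List.range_add, List.flatMap_append]
    exact List.prefix_append _ _
  rw [IsPrefixOf, List.ext_getElem_iff]
  refine ⟨by simp [factorAt], fun i h1 h2 => ?_⟩
  simp only [factorAt, List.getElem_map, List.getElem_range, zero_add, infConcat]
  rcases le_total (i + 1) n with h | h
  · obtain ⟨k, rfl⟩ := Nat.exists_eq_add_of_le h
    exact (hpre _ _).getElem _
  · obtain ⟨k, hk⟩ := Nat.exists_eq_add_of_le h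
    have := hpre n k
    rw [← hk] at this
    exact (this.getElem h2).symm

theorem morph_append {α β : Type*} (h : α → List β) (l l' : List α) :
    morph h (l ++ l') = morph h l ++ morph h l' := by
  simp [morph]

theorem morph_iterate_append {α : Type*} (h : α → List α) (n : ℕ) (l l' : List α) :
    (morph h)^[n] (l ++ l') = (morph h)^[n] l ++ (morph h)^[n] l' := by
  induction n generalizing l l' with
  | zero => rfl
  | succ n ih => simp only [Function.iterate_succ, Function.comp_apply, morph_append, ih]

/-- The fixed point of `f`. -/
def v : ℕ → Fin 3 := omegaWord f 0 [1] f_prolongable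

theorem isPrefixOf_v (n : ℕ) : IsPrefixOf ((morph f)^[n] [0]) v ∧ n ≤ ((morph f)^[n] [0]).length := by
  set b : ℕ → List (Fin 3) := fun n => match n with
    | 0 => [0]
    | k + 1 => (morph f)^[k] [1] with hb
  have hb' : ∀ n, b n ≠ [] := fun n => match n with
    | 0 => List.cons_ne_nil 0 []
    | k + 1 => f_prolongable.2 k
  have h : ∀ n, (List.range (n + 1)).flatMap b = (morph f)^[n] [0] := by
    intro n
    induction n with
    | zero => simp [hb]
    | succ n ih =>
      rw [List.range_succ, List.flatMap_append, ih, Function.iterate_succ_apply]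
      have : morph f [0] = [0] ++ [1] := by simp [morph, f]
      rw [this, morph_iterate_append]
      simp [hb]
  rw [← h]
  exact ⟨isPrefixOf_infConcat b hb' _,
    (Nat.le_succ n).trans (le_length_flatMap_range b hb' (n + 1))⟩

/-- Some iterate `f^n(0)` is long enough to have `l` as a prefix; then `f(l)` is a prefix of
`f^(n+1)(0)`. -/
theorem IsPrefixOf.morph_f {l : List (Fin 3)} (h : IsPrefixOf l v) : IsPrefixOf (morph f l) v := by
  obtain ⟨h1, h2⟩ := isPrefixOf_v l.length
  obtain ⟨d, hd⟩ := Nat.exists_eq_add_of_le h2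
  rw [IsPrefixOf, hd, factorAt_add, h] at h1
  have h3 := (isPrefixOf_v (l.length + 1)).1
  rw [Function.iterate_succ_apply', ← h1, morph_append] at h3
  exact h3.of_append.1

theorem IsPrefixOf.iterate_f {l : List (Fin 3)} (h : IsPrefixOf l v) (e : ℕ) :
    IsPrefixOf ((morph f)^[e] l) v := by
  induction e with
  | zero => exact h
  | succ e ih =>
    rw [Function.iterate_succ_apply']
    exact ih.morph_f

theorem flatMap_range_eq_morph {α β : Type*} (h : α → List β) (u : ℕ → α) (n : ℕ) :
    (List.range n).flatMap (fun k => h (u k)) = morph h (factorAt u 0 n) := by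
  simp [morph, factorAt, List.flatMap_map]

theorem IsPrefixOf.morphInf {α β : Type*} {h : α → List β} {hh : ∀ a, h a ≠ []} {u : ℕ → α}
    {l : List α} (hl : IsPrefixOf l u) : IsPrefixOf (morph h l) (morphInf h hh u) := by
  have := isPrefixOf_infConcat (fun n => h (u n)) (fun n => hh (u n)) l.length
  rwa [flatMap_range_eq_morph, hl] at this

/-- The output of the transducer `τ` for a finite word, from the state `c`. -/
def out : Bool → List (Fin 3) → List (Fin 3)
  | _, [] => []
  | c, a :: l => (bif c then t₂ a else t₁ a) ++ out (!c) l

theorem out_append (c : Bool) (l l' : List (Fin 3)) :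
    out c (l ++ l') = out c l ++ out (xor c (decide (Odd l.length))) l' := by
  induction l generalizing c with
  | nil => simp [out]
  | cons a l ih =>
    rw [List.cons_append, out, out, ih, List.append_assoc, List.length_cons]
    congr 3
    rw [show (decide (Odd (l.length + 1))) = !(decide (Odd l.length)) by
      simp [Nat.odd_add_one, -Nat.not_odd_iff_even]]
    cases c <;> simp

theorem IsPrefixOf.τ {u : ℕ → Fin 3} {l : List (Fin 3)} (hl : IsPrefixOf l u) :
    IsPrefixOf (out false l) (τ u) := by
  have key : ∀ n, (List.range n).flatMap (fun n => if Even n then t₁ (u n) else t₂ (u n)) =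
      out false (factorAt u 0 n) := by
    intro n
    induction n with
    | zero => simp [factorAt, out]
    | succ n ih =>
      rw [List.range_succ, List.flatMap_append, ih, factorAt_add, out_append]
      congr 1
      by_cases hn : Even n
      · simp [hn, Nat.not_odd_iff_even.mpr hn, factorAt, out]
      · simp [hn, Nat.not_even_iff_odd.mp hn, factorAt, out]
  have := isPrefixOf_infConcat (fun n => if Even n then t₁ (u n) else t₂ (u n)) (fun n => by
    by_cases hn : Even n
    · simpa [hn] using t₁_ne_nil (u n)
    · simpa [hn] using t₂_ne_nil (u n)) l.length
  rwa [key, hl] at this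

/-- The action of a letter of `v` on the parity of the number of letters `2`. -/
def flip₂ (a : Fin 3) (c : Bool) : Bool := xor c (decide (a = 2))

/-- The parity of the number of letters `2` in the prefix of length `k` of `v`. -/
def vst : ℕ → Bool
  | 0 => false
  | k + 1 => flip₂ (v k) (vst k)

theorem tracks_vst : Tracks flip₂ v vst := ⟨fun _ => rfl, by decide⟩

theorem flip₂_eq (a : Fin 3) (c : Bool) : flip₂ a c = xor c (decide (Odd (g a).length)) := by
  revert a c; decide

/-- The parity of the length under `g` counts letters 2, and `f 0`, `f 1`, `f 2` contain none, two
and one of them. Hence `vst` gives the transducer state at every level `e` of `img`. -/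
theorem odd_morph_g_f (l : List (Fin 3)) :
    decide (Odd (morph g (morph f l)).length) = decide (Odd (morph g l).length) := by
  have hl : ∀ a, decide (Odd (morph g (f a)).length) = decide (Odd (g a).length) := by decide
  induction l with
  | nil => rfl
  | cons a l ih =>
    have h1 : morph g (morph f (a :: l)) = morph g (f a) ++ morph g (morph f l) := by simp [morph]
    have h2 : morph g (a :: l) = g a ++ morph g l := by simp [morph]
    have h3 := hl a
    simp only [decide_eq_decide] at ih h3 ⊢
    have h4 : Even (morph g (morph f l)).length ↔ Even (morph g l).length := by
      rw [← Nat.not_odd_iff_even, ← Nat.not_odd_iff_even]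
      exact not_congr ih
    rw [h1, h2, List.length_append, List.length_append, Nat.odd_add, Nat.odd_add]
    exact iff_congr h3 h4

theorem vst_eq (k : ℕ) : vst k = decide (Odd (morph g (factorAt v 0 k)).length) := by
  induction k with
  | zero => simp [vst, factorAt, morph]
  | succ k ih =>
    rw [vst, ih, flip₂_eq, factorAt_add, morph_append, List.length_append]
    have h : morph g (factorAt v (0 + k) 1) = g (v k) := by simp [morph, factorAt]
    rw [h]
    by_cases h1 : Odd (morph g (factorAt v 0 k)).length <;> by_cases h2 : Odd (g (v k)).length <;>
      simp [h1, h2, Nat.odd_add, ← Nat.not_odd_iff_even]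

/-- The word `τ(g(f^ω(0)))`. -/
def z : ℕ → Fin 3 := τ (morphInf g g_ne_nil v)

/-- The image of a factor of `v` in `z`. -/
def img (e : ℕ) (c : Bool) (l : List (Fin 3)) : List (Fin 3) := out c (morph g ((morph f)^[e] l))

theorem img_append (e : ℕ) (c : Bool) (l l' : List (Fin 3)) :
    img e c (l ++ l') = img e c l ++ img e (xor c (decide (Odd (morph g l).length))) l' := by
  rw [img, morph_iterate_append, morph_append, out_append, img, img]
  congr 3
  induction e with
  | zero => rfl
  | succ e ih => rw [Function.iterate_succ_apply', odd_morph_g_f, ih]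

/-- The position in `z` of the image of the letter of index `k` of `v`. -/
def zpos (e k : ℕ) : ℕ := (img e false (factorAt v 0 k)).length

theorem factorAt_z (e k n : ℕ) :
    factorAt z (zpos e k) (img e (vst k) (factorAt v k n)).length =
      img e (vst k) (factorAt v k n) := by
  have h : IsPrefixOf (img e false (factorAt v 0 (k + n))) z :=
    ((isPrefixOf_factorAt v (k + n)).iterate_f e).morphInf.τ
  rw [factorAt_add, img_append, Bool.false_xor, ← vst_eq, zero_add] at h
  exact h.of_append.2

theorem zpos_succ (e k : ℕ) : zpos e (k + 1) = zpos e k + (img e (vst k) [v k]).length := by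
  rw [zpos, factorAt_add, img_append, List.length_append, Bool.false_xor, ← vst_eq]
  simp [factorAt, zpos]

/-! ### The word `v` as a coding of itself. -/

/-- The position in `v` of the image of the letter of index `k` of `v`. -/
def vpos (k : ℕ) : ℕ := (morph f (factorAt v 0 k)).length

theorem factorAt_v (k n : ℕ) :
    factorAt v (vpos k) (morph f (factorAt v k n)).length = morph f (factorAt v k n) := by
  have h := (isPrefixOf_factorAt v (k + n)).morph_f
  rw [factorAt_add, morph_append, zero_add] at h
  exact h.of_append.2

theorem vpos_succ (k : ℕ) : vpos (k + 1) = vpos k + (f (v k)).length := by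
  rw [vpos, factorAt_add, morph_append, List.length_append]
  simp [factorAt, vpos, morph]

theorem exists_block {P L : ℕ → ℕ} (h0 : P 0 = 0) (h : ∀ k, P (k + 1) = P k + L k)
    (hL : ∀ k, 0 < L k) (s : ℕ) : ∃ k d, d < L k ∧ s = P k + d := by
  induction s with
  | zero => exact ⟨0, 0, hL 0, h0.symm⟩
  | succ s ih =>
    obtain ⟨k, d, hd, rfl⟩ := ih
    rcases Nat.lt_or_ge (d + 1) (L k) with h' | h'
    · exact ⟨k, d + 1, h', rfl⟩
    · exact ⟨k + 1, 0, hL _, by rw [h]; omega⟩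

theorem morph_f_factorAt_two (k : ℕ) : morph f (factorAt v k 2) = f (v k) ++ f (v (k + 1)) := by
  simp [morph, factorAt, List.range_succ]

theorem getElem?_f_append_f (k t : ℕ) (ht : t < (f (v k) ++ f (v (k + 1))).length) :
    (f (v k) ++ f (v (k + 1)))[t]? = some (v (vpos k + t)) := by
  have h := factorAt_v k 2
  rw [morph_f_factorAt_two] at h
  rw [← getElem?_factorAt v ht, h]

theorem exists_vpos (s : ℕ) : ∃ k d, d < (f (v k)).length ∧ s = vpos k + d :=
  exists_block rfl vpos_succ (fun _ => List.length_pos_iff.mpr (f_ne_nil _)) s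

/-- The factors of length two of `v`. -/
def vPair (a b : Fin 3) : Bool := decide ((a, b) ∈ [(0, 1), (0, 2), (1, 0), (2, 0), (2, 2)])

theorem vPair_v (s : ℕ) : vPair (v s) (v (s + 1)) = true := by
  obtain ⟨k, d, hd, rfl⟩ := exists_vpos s
  have key : ∀ a b : Fin 3, ∀ d < (f a).length, ∃ x y, (f a ++ f b)[d]? = some x ∧
      (f a ++ f b)[d + 1]? = some y ∧ d + 1 < (f a ++ f b).length ∧ vPair x y = true := by decide
  obtain ⟨x, y, h1, h2, h3, h4⟩ := key (v k) (v (k + 1)) d hd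
  rw [getElem?_f_append_f k d (by omega), Option.some_inj] at h1
  rw [getElem?_f_append_f k (d + 1) h3, Option.some_inj] at h2
  rwa [add_assoc, h1, h2]

theorem v_add_two_of_one {s : ℕ} (h : v s = 1) : v (s + 1) = 0 ∧ v (s + 2) = 2 := by
  obtain ⟨k, d, hd, rfl⟩ := exists_vpos s
  have key : ∀ a b : Fin 3, vPair a b = true → ∀ d < (f a).length, (f a ++ f b)[d]? = some 1 →
      d + 2 < (f a ++ f b).length ∧ (f a ++ f b)[d + 1]? = some 0 ∧
        (f a ++ f b)[d + 2]? = some 2 := by decide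
  have h1 := getElem?_f_append_f k d (by rw [List.length_append]; omega)
  obtain ⟨h2, h3, h4⟩ := key _ _ (vPair_v k) d hd (h1.trans (by rw [h]))
  rw [getElem?_f_append_f _ _ (by omega), Option.some_inj] at h3 h4
  exact ⟨h3, h4⟩

theorem v_succ_of_two {s : ℕ} (h : v s = 2) : v (s + 1) = 0 ∨ v (s + 1) = 2 := by
  have key : ∀ b : Fin 3, vPair 2 b = true → b = 0 ∨ b = 2 := by decide
  exact key _ (h ▸ vPair_v s)

theorem v_succ_of_zero {s : ℕ} (h : v s = 0) : v (s + 1) = 1 ∨ v (s + 1) = 2 := by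
  have key : ∀ b : Fin 3, vPair 0 b = true → b = 1 ∨ b = 2 := by decide
  exact key _ (h ▸ vPair_v s)

theorem v_of_succ_ne_zero {s : ℕ} (h : v s ≠ 0) (h' : v (s + 1) ≠ 0) : v s = 2 ∧ v (s + 1) = 2 := by
  have key : ∀ a b : Fin 3, vPair a b = true → a ≠ 0 → b ≠ 0 → a = 2 ∧ b = 2 := by decide
  exact key _ _ (vPair_v s) h h'

theorem v_of_succ_eq_one {s : ℕ} (h : v (s + 1) = 1) : v s = 0 := by
  have key : ∀ a : Fin 3, vPair a 1 = true → a = 0 := by decide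
  exact key _ (h ▸ vPair_v s)

theorem v_around_two_two {s : ℕ} (h : v (s + 1) = 2) (h' : v (s + 2) = 2) :
    v (s + 3) = 0 ∧ ∃ k, v k = 1 ∧ s = vpos k := by
  obtain ⟨k, d, hd, rfl⟩ := exists_vpos s
  have key : ∀ a b : Fin 3, ∀ d < (f a).length, d + 2 < (f a ++ f b).length ∧
      ((f a ++ f b)[d + 1]? = some 2 → (f a ++ f b)[d + 2]? = some 2 →
      a = 1 ∧ d = 0 ∧ d + 3 < (f a ++ f b).length ∧ (f a ++ f b)[d + 3]? = some 0) := by decide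
  obtain ⟨h1, h2⟩ := key (v k) (v (k + 1)) d hd
  rw [getElem?_f_append_f _ _ (by omega), getElem?_f_append_f _ _ h1, ← add_assoc, ← add_assoc, h,
    h'] at h2
  obtain ⟨h3, h4, h5, h6⟩ := h2 rfl rfl
  rw [getElem?_f_append_f _ _ h5, Option.some_inj, ← add_assoc] at h6
  exact ⟨h6, k, h3, by rw [h4, add_zero]⟩

/-- The image under `f` of a letter without its first letter, followed by a marker. -/
def fStr (a : Fin 3) (_ : Bool) (t : ℕ) : Fin 3 :=
  ((![[1, 0], [2, 2, 0], [2, 0]] : Fin 3 → List (Fin 3)) a).getD t 0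

theorem v_vpos (k : ℕ) : v (vpos k) = 0 := by
  have key : ∀ a b : Fin 3, 0 < (f a ++ f b).length ∧ (f a ++ f b)[0]? = some 0 := by decide
  have := key (v k) (v (k + 1))
  rw [getElem?_f_append_f _ _ this.1, Option.some_inj] at this
  exact this.2

/-- Each `f a` is a 0 followed by one of the palindromes 1, 22, 2, none of which contains 0. Thus 0
is a marker, and both reading directions give the same word. -/
theorem coding_v : Coding flip₂ v vst flip₂ v vst vpos 1 (fun a => (f a).length) fStr := by
  have h0 := v_vpos
  have hst : ∀ k, vst (vpos k) = vst k := by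
    intro k
    induction k with
    | zero => rfl
    | succ k ih =>
      have key : ∀ a b : Fin 3, ∀ c, ∃ x y, 1 < (f a ++ f b).length ∧ (f a ++ f b)[0]? = some x ∧
          (f a ++ f b)[1]? = some y ∧ (((f a).length = 2 ∧ flip₂ y (flip₂ x c) = flip₂ a c) ∨
          ∃ w, 2 < (f a ++ f b).length ∧ (f a ++ f b)[2]? = some w ∧ (f a).length = 3 ∧
            flip₂ w (flip₂ y (flip₂ x c)) = flip₂ a c) := by decide
      obtain ⟨x, y, h1, h2, h3, h4⟩ := key (v k) (v (k + 1)) (vst k)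
      rw [getElem?_f_append_f _ _ (by omega), Option.some_inj] at h2 h3
      rw [vpos_succ]
      rcases h4 with ⟨h4, h5⟩ | ⟨w, h6, h7, h4, h5⟩
      · rw [h4, vst, vst, vst, ← h5, ← h2, ← h3, ← ih]; rfl
      · rw [getElem?_f_append_f _ _ (by omega), Option.some_inj] at h7
        rw [h4, vst, vst, vst, vst, ← h5, ← h2, ← h3, ← h7, ← ih]; rfl
  constructor
  · exact tracks_vst
  · exact tracks_vst
  · exact vpos_succ
  · intro k t ht
    have key : ∀ a b : Fin 3, ∀ c, ∀ t < (f a).length, 1 + t < (f a ++ f b).length ∧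
        (f a ++ f b)[1 + t]? = some (fStr a c t) := by decide
    obtain ⟨h1, h2⟩ := key (v k) (v (k + 1)) (vst k) t ht
    rw [getElem?_f_append_f _ _ h1, Option.some_inj, ← add_assoc] at h2
    exact h2
  · intro k t ht s hs
    have key : ∀ a b : Fin 3, ∀ c, ∀ t < (f a).length, (f a).length - 1 - t < (f a ++ f b).length ∧
        (f a ++ f b)[(f a).length - 1 - t]? = some (fStr a c t) := by decide
    obtain ⟨h1, h2⟩ := key (v k) (v (k + 1)) (vst (k + 1)) t ht
    rw [getElem?_f_append_f _ _ h1, Option.some_inj] at h2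
    rw [vpos_succ] at hs
    rwa [show vpos k + ((f (v k)).length - 1 - t) = s by omega] at h2
  · exact one_pos
  · decide
  · intro k s t h1 h2 h3
    rw [show s = t by omega]
  · intro s k h
    obtain ⟨k', d, hd, rfl⟩ := exists_vpos s
    have key : ∀ a b : Fin 3, ∀ d < (f a).length, (f a ++ f b)[d]? = some 0 → d = 0 := by decide
    have h1 := getElem?_f_append_f k' d (by rw [List.length_append]; omega)
    have h2 := h 0 one_pos
    rw [add_zero, add_zero, h0] at h2
    rw [← h2] at h1
    exact ⟨k', by rw [key _ _ d hd h1, add_zero]⟩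
  · intro k k' _ h
    rwa [hst, hst] at h
  · intro k k' _ t ht
    rw [show t = 0 by omega, add_zero, add_zero, h0, h0]
  · intro k k' h
    rwa [hst, hst]
  · intro k
    rw [vst, h0]
    simp [flip₂]
  · intro a b c h
    have key : ∀ (a b : Fin 3) (c : Bool), (∀ t < 3, t < (f a).length → t < (f b).length →
      fStr a c t = fStr b c t) → a = b := by decide
    exact key a b c fun t _ => h t

/-! ### Complete returns in `v`. -/

/-- The sets of letters that can be told apart by the extensions of palindromes. -/
def Good (S : Fin 3 → Bool) : Prop :=
  S = (fun _ => true) ∨ S = (fun a => decide (a ≠ 0)) ∨ S = (fun a => decide (a = 0)) ∨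
    S = (fun a => decide (a = 1)) ∨ S = fun a => decide (a = 2)

instance (S : Fin 3 → Bool) : Decidable (Good S) := by
  unfold Good; infer_instance

/-- This closure property lets the induction in `retAt_v` descend through `f` any number of times.
-/
theorem good_extLetters_v : ∀ T, Good T → ∀ (b : Fin 3) (c : Bool), ∀ l < (f b).length,
    T (fStr b c l) = true → Good (extLetters (fun a => (f a).length) fStr T l b c) := by
  decide

theorem retAt_of_marker {T : Fin 3 → Bool} {I N : ℕ}
    (hret : ∀ n l i, vpos i = I + l → vpos (i + n) + 1 + l = I + N → l < (f (v (i + n))).length →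
      T (fStr (v (i + n)) (vst i) l) = true →
      RetAt v vst (extLetters (fun a => (f a).length) fStr T l (v (i + n)) (vst i)) n i)
    (hmark : ∃ k, I ≤ vpos k ∧ vpos k + 1 ≤ I + N) : RetAt v vst T N I :=
  coding_v.transfer (Or.inl rfl) hret hmark

theorem extLetters_zero (b : Fin 3) (c : Bool) :
    extLetters (fun a => (f a).length) fStr (fun _ => true) 0 b c = fun _ => true := by
  revert b c; decide

theorem flank_true (u : ℕ → Fin 3) (i n : ℕ) : Flank (fun _ => true) u i n :=
  ⟨rfl, fun _ _ => rfl, fun _ _ => rfl⟩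

theorem v_ne_zero_pos {i : ℕ} (h : v i ≠ 0) : ∃ k, i = k + 1 :=
  Nat.exists_eq_succ_of_ne_zero fun hi => h (hi ▸ v_vpos 0)

/-- Here a return leads to the next position with the same state. A letter other than 2 preserves
the state and is itself the return; after a 2 the return ends with the next 2, giving 22, 202 or
20102. -/
theorem retAt_nil (i : ℕ) : RetAt v vst (fun _ => true) 0 i := by
  intro j hij hst _ _ _ _ _ hno
  have hno' : ∀ k, i < k → k < j → vst k ≠ vst i := fun k h1 h2 h3 =>
    hno k h1 h2 h3 (fun t ht => absurd ht (by omega)) (flank_true _ _ _)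
  have hone : ∀ k, vst (k + 1) = flip₂ (v k) (vst k) := fun _ => rfl
  rcases Nat.lt_or_ge (i + 1) j with hj | hj
  swap
  · intro s t h1 h2 h3
    rw [show s = t by omega]
  have h2 : v i = 2 := by
    by_contra hcon
    exact hno' (i + 1) (by omega) hj (by simp [hone, flip₂, hcon])
  have hs1 : vst (i + 1) = !vst i := by simp [hone, flip₂, h2]
  have return_at : ∀ k, i < k → vst k = !vst i → v k = 2 → k < j → j = k + 1 := by
    intro k hk hs hv hkj
    by_contra hcon
    exact hno' (k + 1) (by omega) (by omega) (by simp [hone, flip₂, hs, hv])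
  have go : ∀ k, i < k → k < j → vst k = !vst i → v k ≠ 2 → k + 1 < j ∧ vst (k + 1) = !vst i := by
    intro k hk hkj hs hv
    have hs' : vst (k + 1) = !vst i := by simp [hone, flip₂, hs, hv]
    refine ⟨?_, hs'⟩
    by_contra hcon
    rw [show j = k + 1 by omega, hs'] at hst
    simp at hst
  rcases v_succ_of_two h2 with h3 | h3
  · obtain ⟨hj2, hs2⟩ := go (i + 1) (by omega) hj hs1 (by rw [h3]; decide)
    rcases v_succ_of_zero h3 with h4 | h4
    · obtain ⟨h5, h6⟩ := v_add_two_of_one h4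
      obtain ⟨hj3, hs3⟩ := go (i + 1 + 1) (by omega) hj2 hs2 (by rw [h4]; decide)
      obtain ⟨hj4, hs4⟩ := go (i + 1 + 1 + 1) (by omega) hj3 hs3 (by rw [h5]; decide)
      have := return_at (i + 1 + 1 + 1 + 1) (by omega) hs4 h6 hj4
      subst this
      intro s t q1 q2 q3
      obtain rfl | rfl | rfl | rfl | rfl : s = i ∨ s = i + 1 ∨ s = i + 1 + 1 ∨ s = i + 1 + 1 + 1 ∨
        s = i + 1 + 1 + 1 + 1 := by omega
      · rw [show t = s + 1 + 1 + 1 + 1 by omega, h2]; exact h6.symm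
      · rw [show t = i + 1 + 1 + 1 by omega, h3, h5]
      · rw [show t = i + 1 + 1 by omega]
      · rw [show t = i + 1 by omega, h3, h5]
      · rw [show t = i by omega, h2]; exact h6
    · have := return_at (i + 1 + 1) (by omega) hs2 h4 hj2
      subst this
      intro s t q1 q2 q3
      obtain rfl | rfl | rfl : s = i ∨ s = i + 1 ∨ s = i + 1 + 1 := by omega
      · rw [show t = s + 1 + 1 by omega, h2, h4]
      · rw [show t = i + 1 by omega]
      · rw [show t = i by omega, h2, h4]
  · have := return_at (i + 1) (by omega) hs1 h3 hj
    subst this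
    intro s t q1 q2 q3
    obtain rfl | rfl : s = i ∨ s = i + 1 := by omega
    · rw [show t = s + 1 by omega, h2, h3]
    · rw [show t = i by omega, h2, h3]

theorem exists_vpos_of_zero {s : ℕ} (h : v s = 0) : ∃ k, s = vpos k :=
  coding_v.recog s 0 fun t ht => by
    rw [show t = 0 by omega, add_zero, add_zero, h]
    exact v_vpos 0

/-- The letter 0 is a bare marker, so its preimage is the empty word. -/
theorem retAt_zero {i : ℕ} (h : v i = 0) : RetAt v vst (fun _ => true) 1 i := by
  obtain ⟨k, rfl⟩ := exists_vpos_of_zero h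
  refine retAt_of_marker (fun n l i h1 h2 h3 _ => ?_) ⟨k, le_rfl, le_rfl⟩
  have := coding_v.le_sub i n
  obtain rfl : n = 0 := by omega
  obtain rfl : l = 0 := by omega
  rw [extLetters_zero]
  exact retAt_nil i

/-- Every 1 sits inside 010, which is `f 0` followed by a marker. The preimage is the letter 0,
treated in `retAt_zero`. -/
theorem retAt_one {i : ℕ} (h : v i = 1) {S : Fin 3 → Bool} (hS : S 0 = true) :
    RetAt v vst S 1 i := by
  obtain ⟨i, rfl⟩ := v_ne_zero_pos (show v i ≠ 0 by rw [h]; decide)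
  have aux : ∀ k, Agree v (i + 1) k 1 → 1 ≤ k ∧ v (k - 1) = 0 ∧ v k = 1 ∧ v (k + 1) = 0 := by
    intro k hk
    have h1 := hk 0 one_pos
    rw [add_zero, add_zero, h] at h1
    obtain ⟨k, rfl⟩ := v_ne_zero_pos (show v k ≠ 0 by rw [← h1]; decide)
    exact ⟨by omega, v_of_succ_eq_one h1.symm, h1.symm, (v_add_two_of_one h1.symm).1⟩
  obtain ⟨-, q1, q2, q3⟩ := aux (i + 1) fun _ _ => rfl
  rw [Nat.add_sub_cancel] at q1
  refine retAt_of_extension (d := 1) tracks_vst (by omega) ?_ ?_ ?_ ?_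
  · intro s t h1 h2 h3
    rw [Nat.add_sub_cancel] at h1 h3
    obtain rfl | rfl | rfl : s = i ∨ s = i + 1 ∨ s = i + 1 + 1 := by omega
    · rw [show t = s + 1 + 1 by omega, q1, q3]
    · rw [show t = i + 1 by omega]
    · rw [show t = i by omega, q1, q3]
  · intro k hk _
    obtain ⟨p0, p1, p2, p3⟩ := aux k hk
    refine ⟨p0, fun t ht => ?_⟩
    rw [Nat.add_sub_cancel]
    obtain rfl | rfl | rfl : t = 0 ∨ t = 1 ∨ t = 2 := by omega
    · exact q1.trans p1.symm
    · rw [show k - 1 + 1 = k by omega, p2]; exact q2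
    · rw [show k - 1 + 2 = k + 1 by omega, p3]; exact q3
  · intro k hk hag
    rw [Nat.add_sub_cancel] at hag
    have p0 := hag 0 (by omega)
    have p2 := hag 2 (by omega)
    rw [add_zero, add_zero, q1] at p0
    rw [show i + 2 = i + 1 + 1 by omega, q3, show k - 1 + 2 = k + 1 by omega] at p2
    refine ⟨by rw [← p2]; exact hS, by omega, fun k' hk' => ?_⟩
    rw [show k' = k - 1 by omega, ← p0]
    exact hS
  · rw [Nat.add_sub_cancel]
    obtain ⟨k, rfl⟩ := exists_vpos_of_zero q1
    refine retAt_of_marker (fun n l j h1 h2 h3 _ => ?_) ⟨k, le_rfl, by omega⟩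
    have hle := coding_v.le_sub j n
    -- Either both outer zeros of 010 are the extreme markers, or its middle letter would be the
    -- only one; the latter is impossible because that letter is 1.
    obtain rfl | hn : l = 0 ∨ (l = 1 ∧ n = 0) := by omega
    · have hjk : j = k := coding_v.strictMono.injective (by omega)
      subst hjk
      have hvj : v j = 0 := by
        have h4 := coding_v.fwd j 0 (List.length_pos_iff.mpr (f_ne_nil _))
        rw [add_zero, h1, add_zero, q2] at h4
        have key : ∀ a c, 1 = fStr a c 0 → a = 0 := by decide
        exact key _ _ h4
      have hstep := vpos_succ j
      rw [hvj, show (f 0).length = 2 from rfl] at hstep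
      have hn1 : n = 1 := by
        have : j + n = j + 1 := coding_v.strictMono.injective (by omega)
        omega
      rw [extLetters_zero, hn1]
      exact retAt_zero hvj
    · rw [hn.1] at h1
      have := v_vpos j
      rw [h1, q2] at this
      exact absurd this (by decide)

/-- The factor 22 arises only inside 0220, which is `f 1` followed by a marker, so the preimage is
the letter 1. -/
theorem retAt_two_two {i : ℕ} (h : v i = 2) (h' : v (i + 1) = 2) {S : Fin 3 → Bool}
    (hS : S 0 = true) : RetAt v vst S 2 i := by
  obtain ⟨i, rfl⟩ := v_ne_zero_pos (show v i ≠ 0 by rw [h]; decide)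
  have aux : ∀ k, Agree v (i + 1) k 2 → ∃ k', k = k' + 1 ∧
      v k' = 0 ∧ v (k' + 1) = 2 ∧ v (k' + 2) = 2 ∧ v (k' + 3) = 0 := by
    intro k hk
    have h1 := hk 0 two_pos
    have h2 := hk 1 one_lt_two
    rw [add_zero, add_zero, h] at h1
    rw [h'] at h2
    obtain ⟨k, rfl⟩ := v_ne_zero_pos (show v k ≠ 0 by rw [← h1]; decide)
    obtain ⟨h3, k', -, rfl⟩ := v_around_two_two h1.symm h2.symm
    exact ⟨_, rfl, v_vpos k', h1.symm, h2.symm, h3⟩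
  obtain ⟨i', hi', q0, q1, q2, q3⟩ := aux (i + 1) fun _ _ => rfl
  obtain rfl : i = i' := by omega
  refine retAt_of_extension (d := 1) tracks_vst (by omega) ?_ ?_ ?_ ?_
  · intro s t h1 h2 h3
    rw [Nat.add_sub_cancel] at h1 h3
    obtain rfl | rfl | rfl | rfl : s = i ∨ s = i + 1 ∨ s = i + 2 ∨ s = i + 3 := by omega
    · rw [show t = s + 3 by omega, q0, q3]
    · rw [show t = i + 2 by omega, q1, q2]
    · rw [show t = i + 1 by omega, q1, q2]
    · rw [show t = i by omega, q0, q3]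
  · intro k hk _
    obtain ⟨k, rfl, p0, p1, p2, p3⟩ := aux k hk
    refine ⟨by omega, fun t ht => ?_⟩
    rw [Nat.add_sub_cancel, Nat.add_sub_cancel]
    obtain rfl | rfl | rfl | rfl : t = 0 ∨ t = 1 ∨ t = 2 ∨ t = 3 := by omega
    · exact q0.trans p0.symm
    · exact q1.trans p1.symm
    · exact q2.trans p2.symm
    · exact q3.trans p3.symm
  · intro k hk hag
    obtain ⟨k, rfl⟩ : ∃ k', k = k' + 1 := ⟨k - 1, by omega⟩
    rw [Nat.add_sub_cancel, Nat.add_sub_cancel] at hag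
    have p0 := hag 0 (by omega)
    have p3 := hag 3 (by omega)
    rw [add_zero, add_zero, q0] at p0
    rw [q3] at p3
    refine ⟨by rw [show k + 1 + 2 = k + 3 by omega, ← p3]; exact hS, by omega, fun k' hk' => ?_⟩
    rw [show k' = k by omega, ← p0]
    exact hS
  · rw [Nat.add_sub_cancel]
    obtain ⟨-, k, hvk, rfl⟩ := v_around_two_two q1 q2
    have hstep := vpos_succ k
    rw [hvk, show (f 1).length = 3 from rfl] at hstep
    refine retAt_of_marker (fun n l j h1 h2 h3 _ => ?_) ⟨k, le_rfl, by omega⟩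
    have hle := coding_v.le_sub j n
    obtain rfl | rfl : l = 0 ∨ l = 1 := by omega
    · obtain rfl : j = k := coding_v.strictMono.injective (by omega)
      have hn1 : n = 1 := by
        have : j + n = j + 1 := coding_v.strictMono.injective (by omega)
        omega
      rw [extLetters_zero, hn1]
      exact retAt_one hvk rfl
    · have := v_vpos j
      rw [h1, q1] at this
      exact absurd this (by decide)

/-- For the sets {1, 2} and {2} the neighbours must be 2 and 2, so the empty word extends to 22. For
{0} and {1} there is nothing to prove, as 00 and 11 are not factors of `v`. -/
theorem retAt_nil_of_good {S : Fin 3 → Bool} (hS : Good S) (i : ℕ) : RetAt v vst S 0 i := by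
  have hcase : S = (fun _ => true) ∨ S 0 = false ∧ S 2 = true ∨ (S 0 = false ∨ S 1 = false) ∧
      S 2 = false := by
    revert S; decide
  rcases hcase with rfl | ⟨h0, h2⟩ | hS'
  · exact retAt_nil i
  · have aux : ∀ k, Flank S v k 0 → ∃ k', k = k' + 1 ∧ v k' = 2 ∧ v (k' + 1) = 2 := by
      rintro k ⟨h3, h4, h5⟩
      have hne : ∀ a, S a = true → a ≠ 0 := by
        rintro a ha rfl
        rw [h0] at ha
        exact absurd ha (by decide)
      obtain ⟨k, rfl⟩ := v_ne_zero_pos (hne _ h3)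
      exact ⟨k, rfl, v_of_succ_ne_zero (hne _ (h5 k rfl)) (hne _ h3)⟩
    intro j hij hst hp hst' ha hFi hFj hno
    obtain ⟨i, rfl, q0, q1⟩ := aux i hFi
    refine retAt_of_extension (d := 1) tracks_vst (by omega) ?_ ?_ ?_ ?_ j hij hst hp hst' ha hFi
      hFj hno
    · intro s t h1 h2 h3
      rw [Nat.add_sub_cancel] at h1 h3
      obtain rfl | rfl : s = i ∨ s = i + 1 := by omega
      · rw [show t = s + 1 by omega, q0, q1]
      · rw [show t = i by omega, q0, q1]
    · intro k _ hk
      obtain ⟨k, rfl, p0, p1⟩ := aux k hk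
      refine ⟨by omega, fun t ht => ?_⟩
      rw [Nat.add_sub_cancel, Nat.add_sub_cancel]
      obtain rfl | rfl : t = 0 ∨ t = 1 := by omega
      · exact q0.trans p0.symm
      · exact q1.trans p1.symm
    · intro k hk hag
      obtain ⟨k, rfl⟩ : ∃ k', k = k' + 1 := ⟨k - 1, by omega⟩
      rw [Nat.add_sub_cancel, Nat.add_sub_cancel] at hag
      have p0 := hag 0 (by omega)
      have p1 := hag 1 (by omega)
      rw [add_zero, add_zero, q0] at p0
      rw [q1] at p1
      refine ⟨by rw [add_zero, ← p1]; exact h2, by omega, fun k' hk' => ?_⟩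
      rw [show k' = k by omega, ← p0]
      exact h2
    · rw [Nat.add_sub_cancel]
      exact retAt_two_two q0 q1 rfl
  · intro j hij hst hp hst' ha hFi hFj hno
    exfalso
    obtain ⟨j, rfl⟩ : ∃ k, j = k + 1 := ⟨j - 1, by omega⟩
    have key : ∀ a b, vPair a b = true → S a = true → S b = true → False := by
      clear * - hS'
      revert S; decide
    exact key _ _ (vPair_v j) (hFj.2.2 j rfl) hFj.1

/-- A factor containing 0 has a strictly shorter preimage. The nonempty factors without 0 are 1, 2
and 22, and a single 2 is ruled out because it changes the state. -/
theorem retAt_v (n : ℕ) : ∀ S, Good S → ∀ i, RetAt v vst S n i := by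
  induction n using Nat.strong_induction_on with
  | _ n ih =>
    intro S hS i
    rcases Nat.eq_zero_or_pos n with rfl | hn
    · exact retAt_nil_of_good hS i
    by_cases hm : ∃ k, i ≤ vpos k ∧ vpos k + 1 ≤ i + n
    · refine retAt_of_marker (fun n' l i' h1 h2 h3 h4 => ?_) hm
      have := coding_v.le_sub i' n'
      exact ih n' (by omega) _ (good_extLetters_v S hS _ _ l h3 h4) i'
    have hnz : ∀ t < n, v (i + t) ≠ 0 := by
      intro t ht h0
      obtain ⟨k, hk⟩ := exists_vpos_of_zero h0
      exact hm ⟨k, by omega, by omega⟩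
    intro j hij hst hp hst' ha hFi hFj hno
    obtain rfl | rfl | hn3 : n = 1 ∨ n = 2 ∨ 3 ≤ n := by omega
    · have hv : v i = 1 := by
        have h0 := hnz 0 one_pos
        rw [add_zero] at h0
        have key : ∀ a : Fin 3, a ≠ 0 → ∀ c, flip₂ a c = c → a = 1 := by decide
        exact key _ h0 _ hst'
      refine retAt_one hv ?_ j hij hst hp hst' ha hFi hFj hno
      rw [← (v_add_two_of_one hv).1]
      exact hFi.1
    · have h22 := v_of_succ_ne_zero (hnz 0 (by omega)) (hnz 1 (by omega))
      obtain ⟨i, rfl⟩ := v_ne_zero_pos (hnz 0 (by omega))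
      refine retAt_two_two h22.1 h22.2 ?_ j hij hst hp hst' ha hFi hFj hno
      rw [← (v_around_two_two h22.1 h22.2).1]
      exact hFi.1
    · have h22 := v_of_succ_ne_zero (hnz 0 (by omega)) (hnz 1 (by omega))
      obtain ⟨i, rfl⟩ := v_ne_zero_pos (hnz 0 (by omega))
      exact absurd (v_around_two_two h22.1 h22.2).1 (hnz 2 (by omega))

/-! ### The word `z` as a coding over `v`. -/

theorem getElem?_img_pair (e k t : ℕ) (ht : t < (img e (vst k) [v k, v (k + 1)]).length) :
    (img e (vst k) [v k, v (k + 1)])[t]? = some (z (zpos e k + t)) := by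
  have h := factorAt_z e k 2
  rw [show factorAt v k 2 = [v k, v (k + 1)] by simp [factorAt, List.range_succ]] at h
  rw [← getElem?_factorAt z ht, h]

/-- The output of `τ` for a letter in the state `c`. -/
def tOut (c : Bool) (a : Fin 3) : List (Fin 3) := bif c then t₂ a else t₁ a

/-- The length of the image in `z` of a letter of `v`. -/
def zLen : Fin 3 → ℕ := ![19, 24, 16]

/-- The part of `z` that follows the marker in the image of a letter, up to the end of the next
marker. -/
def zStr (a : Fin 3) (c : Bool) (t : ℕ) : Fin 3 :=
  ((![tOut (!c) 0 ++ tOut c 2, tOut (!c) 1 ++ tOut c 2, tOut (!c) 2] :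
    Fin 3 → List (Fin 3)) a).getD t 0

/-- The markers in `z`. -/
def zMark (c : Bool) (t : ℕ) : Fin 3 := (tOut c 2).getD (t + 2) 0

/-- The position in `z` of the marker in the image of the letter of index `k` of `v`. -/
def zMarkPos (k : ℕ) : ℕ := zpos 0 k + 2

theorem zpos_zero_succ (k : ℕ) : zpos 0 (k + 1) = zpos 0 k + zLen (v k) := by
  have key : ∀ c a, (img 0 c [a]).length = zLen a := by decide
  rw [zpos_succ, key]

theorem zLen_pos (a : Fin 3) : 0 < zLen a := by revert a; decide

theorem exists_zpos (s : ℕ) : ∃ k d, d < zLen (v k) ∧ s = zpos 0 k + d :=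
  exists_block rfl zpos_zero_succ (fun _ => zLen_pos _) s

theorem z_zMarkPos (k t : ℕ) (ht : t < 14) : z (zMarkPos k + t) = zMark (vst k) t := by
  have key : ∀ c a b, ∀ t < 14, 2 + t < (img 0 c [a, b]).length ∧
      (img 0 c [a, b])[2 + t]? = some (zMark c t) := by decide
  obtain ⟨h1, h2⟩ := key (vst k) (v k) (v (k + 1)) t ht
  rw [getElem?_img_pair _ _ _ h1, Option.some_inj, ← add_assoc] at h2
  exact h2

/-- A marker starting in the image of a letter fits into the images of two consecutive letters. Over
all pairs of letters, a finite check finds it only at offset 2. -/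
theorem exists_zMarkPos_of_zMark {s : ℕ} {c : Bool} (h : ∀ t < 14, z (s + t) = zMark c t) :
    ∃ k, s = zMarkPos k := by
  obtain ⟨k, d, hd, rfl⟩ := exists_zpos s
  have key : ∀ c a b, ∀ d < zLen a, d + 13 < (img 0 c [a, b]).length ∧ ∀ c',
      (∀ t < 14, some (zMark c' t) = (img 0 c [a, b])[d + t]?) → d = 2 := by decide
  obtain ⟨h1, h2⟩ := key (vst k) (v k) (v (k + 1)) d hd
  refine ⟨k, ?_⟩
  rw [h2 c fun t ht => ?_, zMarkPos]
  rw [getElem?_img_pair _ _ _ (by omega), ← h t ht, add_assoc]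

/-- The word `t₁ 2` or `t₂ 2` is 00 followed by a palindrome of length 14, which explains the offset
2. The marker starts with 1 or 2 according to the state, so no state has to be carried along `z`. -/
theorem coding_z : Coding flip₂ v vst (fun _ c => c) z (fun _ => false) zMarkPos 14 zLen zStr := by
  constructor
  · exact tracks_vst
  · exact ⟨fun _ => rfl, fun _ _ => rfl⟩
  · intro k
    rw [zMarkPos, zMarkPos, zpos_zero_succ]
    omega
  · intro k t ht
    have key : ∀ c a b, ∀ t < zLen a, 16 + t < (img 0 c [a, b]).length ∧
        (img 0 c [a, b])[16 + t]? = some (zStr a c t) := by decide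
    obtain ⟨h1, h2⟩ := key (vst k) (v k) (v (k + 1)) t ht
    rw [getElem?_img_pair _ _ _ h1, Option.some_inj] at h2
    rw [zMarkPos, ← h2]
    congr 1
    omega
  · intro k t ht s hs
    have key : ∀ c a b, ∀ t < zLen a, zLen a + 1 - t < (img 0 c [a, b]).length ∧
        (img 0 c [a, b])[zLen a + 1 - t]? = some (zStr a (flip₂ a c) t) := by decide
    obtain ⟨h1, h2⟩ := key (vst k) (v k) (v (k + 1)) t ht
    rw [getElem?_img_pair _ _ _ h1, Option.some_inj] at h2
    rw [vst, ← h2]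
    rw [zMarkPos, zpos_zero_succ] at hs
    congr 1
    omega
  · decide
  · decide
  · intro k s t h1 h2 h3
    have key : ∀ c, ∀ t < 14, zMark c t = zMark c (13 - t) := by decide
    obtain ⟨s, rfl⟩ := Nat.exists_eq_add_of_le h1
    rw [z_zMarkPos k s (by omega), key _ _ (by omega), ← z_zMarkPos k _ (by omega)]
    congr 1
    omega
  · intro s k h
    exact exists_zMarkPos_of_zMark fun t ht => by rw [← h t ht, z_zMarkPos k t ht]
  · intro k k' h _
    have key : ∀ c c', zMark c 0 = zMark c' 0 → c = c' := by decide
    have := h 0 (by omega)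
    rw [z_zMarkPos _ _ (by omega), z_zMarkPos _ _ (by omega)] at this
    exact key _ _ this
  · intro k k' h t ht
    rw [z_zMarkPos _ _ ht, z_zMarkPos _ _ ht, h]
  · exact fun _ _ _ => rfl
  · exact fun _ => rfl
  · intro a b c h
    have key : ∀ (a b : Fin 3) (c : Bool), (∀ t < 24, t < zLen a → t < zLen b →
      zStr a c t = zStr b c t) → a = b := by decide
    exact key a b c fun t _ => h t

theorem good_extLetters_z : ∀ (b : Fin 3) (c : Bool), ∀ l < zLen b,
    Good (extLetters zLen zStr (fun _ => true) l b c) := by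
  decide

theorem retAt_z_of_marker {I N : ℕ} (hm : ∃ k, I ≤ zMarkPos k ∧ zMarkPos k + 14 ≤ I + N) :
    RetAt z (fun _ => false) (fun _ => true) N I := by
  refine coding_z.transfer (Or.inr ⟨fun _ => rfl, ?_⟩) (fun n l i _ _ h _ => ?_) hm
  -- Only the two letters 00 precede the first marker, and `zStr` starts with 00 for every letter
  -- and state.
  · rw [show zMarkPos 0 = 2 from rfl]
    decide
  · exact retAt_v n _ (good_extLetters_z _ _ l h) i

/-- A factor of `z` of length at least `38` contains a marker. -/
theorem exists_marker {I N : ℕ} (hN : 38 ≤ N) : ∃ k, I ≤ zMarkPos k ∧ zMarkPos k + 14 ≤ I + N := by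
  -- Consecutive markers start at most 24 positions apart and have length 14, whence the bound 38 =
  -- 24 + 14.
  have hle : ∀ a, zLen a ≤ 24 := by decide
  obtain ⟨k, d, hd, rfl⟩ := exists_zpos I
  have h1 := hle (v k)
  have h2 := hle (v (k + 1))
  have h3 := zpos_zero_succ k
  rcases Nat.lt_or_ge 2 d with h | h
  · exact ⟨k + 1, by rw [zMarkPos]; omega, by rw [zMarkPos]; omega⟩
  · exact ⟨k, by rw [zMarkPos]; omega, by rw [zMarkPos]; omega⟩

/-! ### Palindromes without a marker: the finite computation. -/

/-- The next occurrences in `x` of the palindromes at the position `s` that are shorter than `38`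
and contain no marker of `z` yield palindromic returns. -/
def ShortReturns (x : ℕ → Fin 3) (s : ℕ) : Prop :=
  ∀ n < 38, Pal x s (s + n) →
    (∀ c s', s ≤ s' → s' + 14 ≤ s + n → ∃ t < 14, x (s' + t) ≠ zMark c t) →
    ∃ d > 0, Agree x s (s + d) n ∧ Pal x s (s + d + n) ∧
      ∀ d' > 0, d' < d → ¬ Agree x s (s + d') n

/-- A word over `{0, 1, 2}` as a number in base four. -/
def code : List (Fin 3) → ℕ
  | [] => 0
  | a :: l => a.val + 4 * code l

/-- `force n p = p n`, where `n` is evaluated first. -/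
def force (n : ℕ) (p : ℕ → Bool) : Bool :=
  match n with
  | 0 => p 0
  | n + 1 => p (n + 1)

theorem force_eq (n : ℕ) (p : ℕ → Bool) : force n p = p n := by
  cases n <;> rfl

/-- Given the code `W` of a word of length `L` and the code `R` of a word that begins with the
reversal of that word, whether the prefix of length `n` of the word is a palindrome. -/
def isPal (L W R n : ℕ) : Bool :=
  Nat.beq (Nat.mod W (Nat.pow 4 n)) (Nat.mod (Nat.div R (Nat.pow 4 (Nat.sub L n))) (Nat.pow 4 n))

/-- Whether the first occurrence of the prefix of length `n` of a word of length `L` that begins at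
a distance between `d` and `d + k - 1` exists and yields a palindromic return. The word and its
reversal have the codes `W` and `R`, `X` is the code of the suffix that begins at the distance `d`,
`q = 4 ^ n` and `p` is the code of the prefix. -/
noncomputable def checkReturn (L W R n q p k : ℕ) : ℕ → ℕ → Bool :=
  Nat.rec (motive := fun _ => ℕ → ℕ → Bool) (fun _ _ => false) (fun _ ih d X =>
    Bool.rec (ih (Nat.succ d) (Nat.div X 4))
      (Nat.ble (Nat.add d n) L && isPal L W R (Nat.add d n)) (Nat.beq (Nat.mod X q) p)) k

/-- Whether the returns to the palindromic prefixes, of lengths between `n` and `n + k - 1`, of a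
word are palindromes. The check ends with the first prefix that has a suffix of length `14` with the
code `M₁` or `M₂`. -/
noncomputable def checkPrefixes (M₁ M₂ L W R : ℕ) : ℕ → ℕ → Bool
  | 0, _ => true
  | k + 1, n =>
    (Nat.ble 14 n && (Nat.beq (Nat.mod (Nat.div W (Nat.pow 4 (Nat.sub n 14))) (Nat.pow 4 14)) M₁ ||
      Nat.beq (Nat.mod (Nat.div W (Nat.pow 4 (Nat.sub n 14))) (Nat.pow 4 14)) M₂)) ||
    ((!isPal L W R n || force (Nat.pow 4 n) fun q => force (Nat.mod W q) fun p =>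
      checkReturn L W R n q p L 1 (Nat.div W 4)) && checkPrefixes M₁ M₂ L W R k (Nat.succ n))

/-- The check `checkPrefixes` for the first `k` suffixes of a word. -/
noncomputable def checkPositions (M₁ M₂ R : ℕ) : ℕ → ℕ → ℕ → Bool
  | 0, _, _ => true
  | k + 1, L, W => force W fun W => force L fun L =>
    checkPrefixes M₁ M₂ L W R 38 0 && checkPositions M₁ M₂ R k (Nat.pred L) (Nat.div W 4)

/-- The code of the marker. -/
def markCode (c : Bool) : ℕ := code ((tOut c 2).drop 2)

theorem code_digit (l : List (Fin 3)) (t : ℕ) : code l / 4 ^ t % 4 = (l.getD t 0).val := by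
  induction l generalizing t with
  | nil => simp [code]
  | cons a l ih =>
    cases t with
    | zero => simp only [code, pow_zero, Nat.div_one, List.getD_cons_zero]; omega
    | succ t =>
      rw [List.getD_cons_succ, ← ih, code, pow_succ', ← Nat.div_div_eq_div_mul]
      congr 2
      omega

theorem mod_pow_eq_iff (A B n : ℕ) :
    A % 4 ^ n = B % 4 ^ n ↔ ∀ t < n, A / 4 ^ t % 4 = B / 4 ^ t % 4 := by
  induction n with
  | zero => simp [Nat.mod_one]
  | succ n ih =>
    have hA : A % 4 ^ n < 4 ^ n := Nat.mod_lt _ (by positivity)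
    have hB : B % 4 ^ n < 4 ^ n := Nat.mod_lt _ (by positivity)
    rw [Nat.mod_pow_succ, Nat.mod_pow_succ, Nat.forall_lt_succ_right, ← ih]
    constructor
    · intro h
      have h1 := congrArg (· % 4 ^ n) h
      have h2 := congrArg (· / 4 ^ n) h
      simp only [Nat.add_mul_mod_self_left, Nat.mod_mod] at h1
      simp only [Nat.add_mul_div_left _ _ (show 0 < 4 ^ n by positivity), Nat.div_eq_of_lt hA,
        Nat.div_eq_of_lt hB, zero_add] at h2
      exact ⟨h1, h2⟩
    · rintro ⟨h1, h2⟩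
      rw [h1, h2]

section Check

variable {x : ℕ → Fin 3} {s L W R : ℕ}

theorem isPal_iff (hW : ∀ t < L, W / 4 ^ t % 4 = (x (s + t)).val)
    (hR : ∀ t < L, R / 4 ^ t % 4 = (x (s + L - 1 - t)).val) {n : ℕ} (hn : n ≤ L) :
    isPal L W R n = true ↔ Pal x s (s + n) := by
  have h : isPal L W R n = true ↔ W % 4 ^ n = R / 4 ^ (L - n) % 4 ^ n := by
    rw [isPal, Nat.beq_eq]; rfl
  rw [h, mod_pow_eq_iff]
  have key : ∀ t < n, (W / 4 ^ t % 4 = R / 4 ^ (L - n) / 4 ^ t % 4 ↔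
      x (s + t) = x (s + (n - 1 - t))) := by
    intro t ht
    rw [Nat.div_div_eq_div_mul, ← pow_add, hW t (by omega), hR _ (by omega), Fin.val_inj,
      show s + L - 1 - (L - n + t) = s + (n - 1 - t) by omega]
  constructor
  · intro h a b h1 h2 h3
    have := (key (a - s) (by omega)).mp (h _ (by omega))
    rwa [show s + (a - s) = a by omega, show s + (n - 1 - (a - s)) = b by omega] at this
  · intro h t ht
    exact (key t ht).mpr (h _ _ (by omega) (by omega) (by omega))

theorem mod_pow_eq_iff_agree (hW : ∀ t < L, W / 4 ^ t % 4 = (x (s + t)).val) {d n : ℕ}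
    (h : d + n ≤ L) : W / 4 ^ d % 4 ^ n = W % 4 ^ n ↔ Agree x s (s + d) n := by
  rw [mod_pow_eq_iff]
  refine forall₂_congr fun t ht => ?_
  rw [Nat.div_div_eq_div_mul, ← pow_add, hW _ (by omega), hW _ (by omega), Fin.val_inj, add_assoc]
  exact eq_comm

theorem of_checkReturn (hW : ∀ t < L, W / 4 ^ t % 4 = (x (s + t)).val)
    (hR : ∀ t < L, R / 4 ^ t % 4 = (x (s + L - 1 - t)).val) {n k d : ℕ}
    (h : checkReturn L W R n (4 ^ n) (W % 4 ^ n) k d (W / 4 ^ d) = true) :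
    ∃ e ≥ d, e + n ≤ L ∧ Agree x s (s + e) n ∧ Pal x s (s + e + n) ∧
      ∀ d' ≥ d, d' < e → ¬ Agree x s (s + d') n := by
  induction k generalizing d with
  | zero => exact absurd h Bool.false_ne_true
  | succ k ih =>
    have hstep : checkReturn L W R n (4 ^ n) (W % 4 ^ n) (k + 1) d (W / 4 ^ d) =
        Bool.rec (checkReturn L W R n (4 ^ n) (W % 4 ^ n) k (d + 1) (W / 4 ^ d / 4))
          (Nat.ble (d + n) L && isPal L W R (d + n))
          (Nat.beq (W / 4 ^ d % 4 ^ n) (W % 4 ^ n)) := rfl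
    rw [hstep, Nat.div_div_eq_div_mul, ← pow_succ] at h
    cases hb : Nat.beq (W / 4 ^ d % 4 ^ n) (W % 4 ^ n) with
    | false =>
      rw [hb] at h
      obtain ⟨e, h1, h2, h3, h4, h5⟩ := ih h
      refine ⟨e, by omega, h2, h3, h4, fun d' hd1 hd2 hag => ?_⟩
      rcases Nat.eq_or_lt_of_le hd1 with rfl | hlt
      · rw [← mod_pow_eq_iff_agree hW (by omega)] at hag
        exact Nat.ne_of_beq_eq_false hb hag
      · exact h5 d' hlt hd2 hag
    | true =>
      rw [hb] at h
      replace h : (Nat.ble (d + n) L && isPal L W R (d + n)) = true := h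
      rw [Bool.and_eq_true, Nat.ble_eq] at h
      refine ⟨d, le_rfl, h.1, ?_, ?_, fun d' h1 h2 => absurd h1 (by omega)⟩
      · exact (mod_pow_eq_iff_agree hW h.1).mp (Nat.eq_of_beq_eq_true hb)
      · rw [add_assoc]
        exact (isPal_iff hW hR h.1).mp h.2

theorem markCode_eq {c : Bool} (hW : ∀ t < L, W / 4 ^ t % 4 = (x (s + t)).val) {n : ℕ} (hn : n ≤ L)
    (hn' : 14 ≤ n) (h : W / 4 ^ (n - 14) % 4 ^ 14 = markCode c) :
    ∀ t < 14, x (s + (n - 14) + t) = zMark c t := by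
  have h1 : ∀ c, markCode c = markCode c % 4 ^ 14 := by decide
  have h2 : ∀ c, ∀ t < 14, markCode c / 4 ^ t % 4 = (zMark c t).val := by decide
  rw [h1, mod_pow_eq_iff] at h
  intro t ht
  have := h t ht
  rwa [Nat.div_div_eq_div_mul, ← pow_add, hW _ (by omega), h2 c t ht, Fin.val_inj, ← add_assoc]
    at this

theorem shortReturns_of_checkPrefixes (hW : ∀ t < L, W / 4 ^ t % 4 = (x (s + t)).val)
    (hR : ∀ t < L, R / 4 ^ t % 4 = (x (s + L - 1 - t)).val) (hL : 38 ≤ L)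
    (h : checkPrefixes (markCode false) (markCode true) L W R 38 0 = true) : ShortReturns x s := by
  have key : ∀ k n, checkPrefixes (markCode false) (markCode true) L W R k n = true →
      ∀ n', n ≤ n' → n' < n + k → n' ≤ L → Pal x s (s + n') →
      (∀ c s', s ≤ s' → s' + 14 ≤ s + n' → ∃ t < 14, x (s' + t) ≠ zMark c t) →
      ∃ d > 0, Agree x s (s + d) n' ∧ Pal x s (s + d + n') ∧
        ∀ d' > 0, d' < d → ¬ Agree x s (s + d') n' := by
    intro k
    induction k with
    | zero => intro n _ n' h1 h2; omega
    | succ k ih =>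
      intro n h n' h1 h2 hn' hp hm
      rw [checkPrefixes, Bool.or_eq_true, Bool.and_eq_true, Bool.and_eq_true, Bool.or_eq_true,
        Bool.or_eq_true, force_eq, force_eq] at h
      rcases h with ⟨ha, hb⟩ | ⟨ha, hb⟩
      · exfalso
        have hc : ∃ c, W / 4 ^ (n - 14) % 4 ^ 14 = markCode c := by
          rcases hb with hb | hb
          · exact ⟨false, Nat.eq_of_beq_eq_true hb⟩
          · exact ⟨true, Nat.eq_of_beq_eq_true hb⟩
        obtain ⟨c, hc⟩ := hc
        have hn14 := Nat.le_of_ble_eq_true ha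
        obtain ⟨t, ht, ht'⟩ := hm c (s + (n - 14)) (by omega) (by omega)
        exact ht' (markCode_eq hW (by omega) hn14 hc t ht)
      · rcases Nat.eq_or_lt_of_le h1 with rfl | hlt
        · rw [(isPal_iff hW hR hn').mpr hp] at ha
          replace ha := ha.resolve_left (by decide)
          obtain ⟨e, q1, -, q3, q4, q5⟩ := of_checkReturn (n := n) (k := L) (d := 1) hW hR
            (by rw [pow_one]; exact ha)
          exact ⟨e, q1, q3, q4, q5⟩
        · exact ih _ hb n' hlt (by simp only [Nat.succ_eq_add_one]; omega) hn' hp hm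
  intro n hn hp hm
  exact key 38 0 h n (by omega) (by omega) (by omega) hp hm

/-- Deleting the first letter of a word deletes the last letter of its reversal. Hence the same `R`
serves all suffixes while `L` and `W` shrink. -/
theorem shortReturns_of_checkPositions {k : ℕ}
    (hW : ∀ t < L, W / 4 ^ t % 4 = (x (s + t)).val)
    (hR : ∀ t < L, R / 4 ^ t % 4 = (x (s + L - 1 - t)).val) (hL : k + 38 ≤ L)
    (h : checkPositions (markCode false) (markCode true) R k L W = true) :
    ∀ i < k, ShortReturns x (s + i) := by
  induction k generalizing s L W with
  | zero => intro i hi; omega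
  | succ k ih =>
    rw [checkPositions, force_eq, force_eq, Bool.and_eq_true] at h
    intro i hi
    rcases i with _ | i
    · exact shortReturns_of_checkPrefixes hW hR (by omega) h.1
    · rw [show s + (i + 1) = s + 1 + i by omega]
      have hL1 : Nat.pred L = L - 1 := rfl
      refine ih (L := Nat.pred L) (W := W / 4) (fun t ht => ?_) (fun t ht => ?_) (by omega) h.2 i
        (by omega)
      · rw [Nat.div_div_eq_div_mul, ← pow_succ', hW _ (by omega), add_assoc, add_comm 1 t]
      · rw [hR t (by omega)]
        congr 2
        omega

end Check

/-- A prefix of the image in `z`, up to a permutation of the letters, of every factor of `v` of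
length three that begins with `a b`. -/
def window (a b : Fin 3) : List (Fin 3) :=
  out false (morph g ((morph f)^[4] [a, b] ++ (morph f)^[3] [0]))

/-- The check `checkPositions` for the positions in the image of `a`. -/
noncomputable def checkWindow (a b : Fin 3) : Bool :=
  force (code (window a b)) fun W => force (code (window a b).reverse) fun R =>
    force (window a b).length fun L => force (img 4 false [a]).length fun k =>
      force (markCode false) fun M₁ => force (markCode true) fun M₂ =>
        Nat.ble (k + 38) L && checkPositions M₁ M₂ R k L W

/-- This and the next four checks cover all factors of length two of `v`. Their success shows that
the windows are long enough to contain every next occurrence needed. -/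
theorem checkWindow_zero_one : checkWindow 0 1 = true := by decide +kernel

theorem checkWindow_zero_two : checkWindow 0 2 = true := by decide +kernel

theorem checkWindow_one_zero : checkWindow 1 0 = true := by decide +kernel

theorem checkWindow_two_zero : checkWindow 2 0 = true := by decide +kernel

theorem checkWindow_two_two : checkWindow 2 2 = true := by decide +kernel

theorem checkWindow_of_vPair {a b : Fin 3} (h : vPair a b = true) : checkWindow a b = true := by
  have key : ∀ a b : Fin 3, vPair a b = true → (a = 0 ∧ b = 1) ∨ (a = 0 ∧ b = 2) ∨
      (a = 1 ∧ b = 0) ∨ (a = 2 ∧ b = 0) ∨ (a = 2 ∧ b = 2) := by decide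
  obtain ⟨rfl, rfl⟩ | ⟨rfl, rfl⟩ | ⟨rfl, rfl⟩ | ⟨rfl, rfl⟩ | ⟨rfl, rfl⟩ := key a b h
  · exact checkWindow_zero_one
  · exact checkWindow_zero_two
  · exact checkWindow_one_zero
  · exact checkWindow_two_zero
  · exact checkWindow_two_two

theorem shortReturns_of_window {x : ℕ → Fin 3} {s : ℕ} {a b : Fin 3} (h : vPair a b = true)
    (hx : ∀ t < (window a b).length, (window a b)[t]? = some (x (s + t))) :
    ∀ i < (img 4 false [a]).length, ShortReturns x (s + i) := by
  have hc := checkWindow_of_vPair h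
  simp only [checkWindow, force_eq] at hc
  rw [Bool.and_eq_true, Nat.ble_eq] at hc
  have hd : ∀ t < (window a b).length, (window a b).getD t 0 = x (s + t) := fun t ht => by
    rw [List.getD_eq_getElem?_getD, hx t ht]
    rfl
  refine shortReturns_of_checkPositions (fun t ht => ?_) (fun t ht => ?_) hc.1 hc.2
  · rw [code_digit, hd t ht]
  · rw [code_digit, List.getD_eq_getElem?_getD, List.getElem?_reverse ht, hx _ (by omega)]
    simp only [Option.getD_some]
    congr 2
    omega

/-- The permutation of the letters that exchanges the states of the transducer. -/
def recolor (c : Bool) (a : Fin 3) : Fin 3 := bif c then ![0, 2, 1] a else a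

theorem recolor_recolor (c : Bool) (a : Fin 3) : recolor c (recolor c a) = a := by
  revert c a; decide

theorem out_eq_map_recolor (c : Bool) (l : List (Fin 3)) :
    out c l = (out false l).map (recolor c) := by
  have h1 : ∀ c a, (bif c then t₂ a else t₁ a) = (t₁ a).map (recolor c) := by decide
  have h2 : ∀ c a, recolor (!c) a = recolor c (recolor (!false) a) := by decide
  induction l generalizing c with
  | nil => rfl
  | cons a l ih =>
    rw [out, out, ih (!c), ih (!false), List.map_append, h1, List.map_map]
    congr 1
    exact List.map_congr_left fun b _ => h2 c b

/-- Exchanging 1 and 2 preserves palindromes and equality of factors, and it swaps the two markers.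
So windows need only be computed from the initial state. -/
theorem ShortReturns.of_recolor {x : ℕ → Fin 3} {s : ℕ} {c : Bool}
    (h : ShortReturns (fun t => recolor c (x t)) s) : ShortReturns x s := by
  have hinj : ∀ a b, recolor c a = recolor c b ↔ a = b := fun a b =>
    ⟨fun h => by rw [← recolor_recolor c a, h, recolor_recolor], fun h => by rw [h]⟩
  have hmark : ∀ c c', ∀ t < 14, recolor c (zMark (xor c c') t) = zMark c' t := by decide
  intro n hn hp hm
  have := h n hn (fun a b h1 h2 h3 => congrArg (recolor c) (hp a b h1 h2 h3)) fun c' s' h1 h2 => by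
    obtain ⟨t, ht, ht'⟩ := hm (xor c c') s' h1 h2
    refine ⟨t, ht, fun heq => ht' ?_⟩
    rwa [← hmark c c' t ht, hinj] at heq
  simpa only [Agree, Pal, hinj] using this

/-- Cut `z` into the images of `f^4(v k)`. The image of `f^4(v (k+2))` begins with that of `f^3(0)`,
because each `f a` starts with 0. So the window of `v k` and `v (k+1)`, recoloured by the state,
occurs at each cut. -/
theorem shortReturns_z (s : ℕ) : ShortReturns z s := by
  have hpos : ∀ a : Fin 3, 0 < (img 4 false [a]).length := by decide +kernel
  have hlen : ∀ c l, (img 4 c l).length = (img 4 false l).length := fun c l => by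
    rw [img, out_eq_map_recolor, List.length_map]; rfl
  obtain ⟨k, d, hd, rfl⟩ := exists_block (P := zpos 4) (L := fun k => (img 4 false [v k]).length) rfl
    (fun k => by rw [zpos_succ, hlen]) (fun k => hpos _) s
  refine ShortReturns.of_recolor (c := vst k) ?_
  refine shortReturns_of_window (x := fun t => recolor (vst k) (z t)) (vPair_v k) (fun t ht => ?_) d hd
  have hw := factorAt_z 4 k 3
  obtain ⟨r, hr⟩ : ∃ r, img 4 (vst k) (factorAt v k 3) =
      (window (v k) (v (k + 1))).map (recolor (vst k)) ++ r := by
    have hf : ∀ a : Fin 3, ∃ r, morph f [a] = [0] ++ r := by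
      intro a; fin_cases a <;> exact ⟨_, rfl⟩
    obtain ⟨r, hr⟩ := hf (v (k + 2))
    have hv : factorAt v k 3 = [v k, v (k + 1)] ++ [v (k + 2)] := by
      simp [factorAt, List.range_succ]
    rw [img, hv, morph_iterate_append, Function.iterate_succ_apply (morph f) 3 [v (k + 2)], hr,
      morph_iterate_append, ← List.append_assoc, morph_append, out_append, window,
      ← out_eq_map_recolor]
    exact ⟨_, rfl⟩
  have h2 := congrArg (·[t]?) hw
  rw [getElem?_factorAt _ (by rw [hr]; simp only [List.length_append, List.length_map]; omega), hr,
    List.getElem?_append_left (by simpa using ht), List.getElem?_map] at h2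
  rw [List.getElem?_eq_getElem ht, Option.map_some, Option.some_inj] at h2
  rw [List.getElem?_eq_getElem ht, h2, recolor_recolor]

/-! ### Conclusion. -/

theorem infRich_z : InfRich z := by
  refine infRich_of_returns fun I J N hIJ hp ha hno => ?_
  by_cases hm : ∃ k, I ≤ zMarkPos k ∧ zMarkPos k + 14 ≤ I + N
  · exact retAt_z_of_marker hm J hIJ rfl hp rfl ha (flank_true _ _ _) (flank_true _ _ _)
      fun k h1 h2 _ h3 _ => hno k h1 h2 h3
  · have hN : N < 38 := by
      by_contra hcon
      exact hm (exists_marker (by omega))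
    obtain ⟨d, hd, h1, h2, h3⟩ := shortReturns_z I N hN hp fun c s' q1 q2 => by
      by_contra! hcon
      obtain ⟨k, rfl⟩ := exists_zMarkPos_of_zMark hcon
      exact hm ⟨k, q1, q2⟩
    -- Both `J` and `I + d` are the first occurrence after `I`.
    have hJ : J = I + d := by
      rcases Nat.lt_trichotomy J (I + d) with h | h | h
      · refine absurd ?_ (h3 (J - I) (by omega) (by omega))
        rwa [show I + (J - I) = J by omega]
      · exact h
      · exact absurd h1 (hno (I + d) (by omega) h)
    rw [hJ]
    exact h2

end RichWords

theorem mainTheorem4 :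
    RichWords.InfRich
      (RichWords.τ (RichWords.morphInf RichWords.g RichWords.g_ne_nil
        (RichWords.omegaWord RichWords.f 0 [1] RichWords.f_prolongable))) :=
  RichWords.infRich_z
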